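/- Let $k$ be a field, $V=\mathrm{span}_k\{x_1,\dots,x_s\}$, and let $A=T(V)/I$ be a monomial algebra, where $I$ is the two-sided ideal generated by finitely many monomials of degree at least $2$. For a monomial $m$ let $\mathfrak A_m$ be the set of monomials $w\notin I$ such that $w\otimes m\in I$ but $v\otimes m\notin I$ for every proper right factor $v$ of $w$. Put $\mathfrak G_0=\{x_1,\dots,x_s\}$, $\mathfrak G_{i}=\bigcup_{m\in\mathfrak G_{i-1}}\mathfrak A_m$ for $i\ge 1$, and let $\Gamma(A)$ be the directed graph with vertex set $\bigcup_{i\ge0}\mathfrak G_i$ and an edge $m\to w$ whenever $w\in\mathfrak A_m$. A walk $v_0v_1\cdots v_n$ has length $n$; a path is a walk without repeated vertices; a circuit is a closed walk $v_0\cdots v_n$, $n\ge1$, $v_n=v_0$, with $v_0,\dots,v_{n-1}$ distinct, considered up to the choice of its initial vertex. Let $E(A)=\bigoplus_{i\ge0}E^i(A)$, $E^i(A)=\mathrm{Ext}^i_A(k,k)$, be the Yoneda algebra (left $A$-modules), graded by cohomological degree, and let $$\mathrm{GKdim}(E(A))=\limsup_{n\to\infty}\frac{\log\sum_{i\le n}\dim_kE^i(A)}{\log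 n}$$ be its Gelfand–Kirillov dimension as a graded algebra. The graph $\Gamma(A)$ is finite, every $E^i(A)$ is finite dimensional, and, whenever $E(A)$ is finitely generated as a $k$-algebra, this number equals the usual Gelfand–Kirillov dimension $\sup_U\limsup_n \log\dim(k+U+\cdots+U^n)/\log n$, with $U$ running over the finite-dimensional subspaces of $E(A)$. Moreover: 1. If $\Gamma(A)$ contains no circuit, then $\mathrm{gl.dim}(A)$ is the number of vertices of a longest path in $\Gamma(A)$, i.e. one more than the length of a longest path (and $0$ if $s=0$). Otherwise $\mathrm{gl.dim}(A)=\infty$. 2. $\mathrm{GKdim}(E(A))=\infty$ if and only if $\Gamma(A)$ contains two distinct circuits with a common vertex. 3. If no two distinct circuits in $\Gamma(A)$ have a common vertex, then $\mathrm{GKdim}(E(A))$ is the maximal number of distinct circuits contained in a walk in $\Gamma(A)$. 4. The Hilbert series $\sum_{i\ge0}\dim_k E^i(A)\,t^i$ of $E(A)$ is a rational function. -/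

import Mathlib

open CategoryTheory CategoryTheory.Abelian
open scoped ENNReal

universe u

noncomputable section

namespace CPS

/-! ### Monomial algebras -/

section Monomial

variable (k : Type u) [Field k] {s : ℕ}

/-- The monomial of the free algebra `T(V)`, `V = span {x_1, ..., x_s}`, spelled by a word. -/
def monomial (w : FreeMonoid (Fin s)) : FreeAlgebra k (Fin s) :=
  FreeMonoid.lift (FreeAlgebra.ι k) w

/-- The two-sided ideal `I` of `T(V)` generated by the monomials in `R`. -/
def monomialIdeal (R : Finset (FreeMonoid (Fin s))) : TwoSidedIdeal (FreeAlgebra k (Fin s)) :=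
  TwoSidedIdeal.span {f | ∃ r ∈ R, f = monomial k r}

/-- The monomial algebra `A = T(V)/I`. -/
abbrev MonomialAlgebra (R : Finset (FreeMonoid (Fin s))) : Type u :=
  (monomialIdeal k R).ringCon.Quotient

/-- The augmentation `T(V) → k` with kernel `T(V)_+`. -/
def freeAugmentation : FreeAlgebra k (Fin s) →ₐ[k] k :=
  FreeAlgebra.lift k (fun _ => 0)

variable {k} in
lemma freeAugmentation_monomial {w : FreeMonoid (Fin s)} (hw : w ≠ 1) :
    freeAugmentation k (monomial k w) = 0 := by
  induction w using FreeMonoid.casesOn with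
  | one => exact absurd rfl hw
  | of_mul a w => simp [monomial, freeAugmentation]

/-- All monomials in `R` have degree at least `2`. -/
def DegreesAtLeastTwo (R : Finset (FreeMonoid (Fin s))) : Prop :=
  ∀ r ∈ R, 2 ≤ r.length

lemma monomialIdeal_le_ker {R : Finset (FreeMonoid (Fin s))} (hR : DegreesAtLeastTwo R) :
    (monomialIdeal k R).ringCon ≤ RingCon.ker (freeAugmentation k (s := s)).toRingHom := by
  have h : monomialIdeal k R ≤ TwoSidedIdeal.ker (freeAugmentation k (s := s)) := by
    refine TwoSidedIdeal.span_le.2 ?_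
    rintro _ ⟨r, hr, rfl⟩
    refine (TwoSidedIdeal.mem_ker _).2 (freeAugmentation_monomial ?_)
    rintro rfl
    simpa using hR 1 hr
  intro x y hxy
  have hm := (TwoSidedIdeal.mem_ker _).1 (h ((TwoSidedIdeal.rel_iff _ x y).1 hxy))
  rw [map_sub, sub_eq_zero] at hm
  exact hm

/-- The augmentation `A → k` of the monomial algebra, with kernel `A_+`. -/
def augmentation {R : Finset (FreeMonoid (Fin s))} (hR : DegreesAtLeastTwo R) :
    MonomialAlgebra k R →ₐ[k] k :=
  RingCon.liftₐ (monomialIdeal k R).ringCon (freeAugmentation k) (monomialIdeal_le_ker k hR)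

/-- The trivial left `A`-module `k = A/A_+`. -/
def trivialModule {R : Finset (FreeMonoid (Fin s))} (hR : DegreesAtLeastTwo R) :
    ModuleCat.{u} (MonomialAlgebra k R) :=
  (ModuleCat.restrictScalars (augmentation k hR).toRingHom).obj (ModuleCat.of k k)

end Monomial

/-! ### The Yoneda algebra of an object of a `k`-linear abelian category -/

section Yoneda

variable (k : Type u) [Field k] {C : Type*} [Category* C] [Abelian C] [Linear k C]
  [HasExt.{u} C]

/-- The graded pieces of the Yoneda algebra of `M`. -/
abbrev YonedaPiece (M : C) (i : ℕ) : Type u := Ext.{u} M M i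

/-- The Yoneda product of `a ∈ Ext^i` and `b ∈ Ext^j` is the composite "first `b`, then `a`". -/
instance (M : C) : GradedMonoid.GMul (YonedaPiece M) where
  mul {i j} a b := Ext.comp b a (add_comm j i)

instance (M : C) : GradedMonoid.GOne (YonedaPiece M) where
  one := Ext.mk₀ (𝟙 M)

lemma mk_comp_eq {M : C} {i j n m : ℕ} (a : YonedaPiece M i) (b : YonedaPiece M j)
    (h : i + j = n) (h' : i + j = m) :
    (GradedMonoid.mk n (Ext.comp a b h) : GradedMonoid (YonedaPiece M)) =
      GradedMonoid.mk m (Ext.comp a b h') := by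
  subst h h'; rfl

instance (M : C) : DirectSum.GRing (YonedaPiece M) where
  mul_zero {i j} a := Ext.zero_comp M j a (i + j) (add_comm j i)
  zero_mul {i j} b := Ext.comp_zero b M i (i + j) (add_comm j i)
  mul_add a b c := Ext.add_comp _ _ _ _
  add_mul a b c := Ext.comp_add _ _ _ _
  one_mul := by
    rintro ⟨i, a⟩
    refine (mk_comp_eq a (Ext.mk₀ (𝟙 M)) _ (add_zero i)).trans ?_
    rw [Ext.comp_mk₀_id]
    rfl
  mul_one := by
    rintro ⟨i, a⟩
    refine (mk_comp_eq (Ext.mk₀ (𝟙 M)) a _ (zero_add i)).trans ?_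
    rw [Ext.mk₀_id_comp]
    rfl
  mul_assoc := by
    rintro ⟨i, a⟩ ⟨j, b⟩ ⟨l, c⟩
    have h : Ext.comp (Ext.comp c b (add_comm l j)) a (by omega : j + l + i = i + (j + l)) =
        Ext.comp c (Ext.comp b a (add_comm j i)) (by omega) :=
      Ext.comp_assoc _ _ _ _ _ (by omega)
    refine Eq.trans ?_ (congrArg (GradedMonoid.mk (i + (j + l))) h.symm)
    exact mk_comp_eq c (Ext.comp b a (add_comm j i)) _ _
  natCast n := n • Ext.mk₀ (𝟙 M)
  natCast_zero := zero_smul _ _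
  natCast_succ n := succ_nsmul _ _
  intCast n := n • Ext.mk₀ (𝟙 M)
  intCast_ofNat n := natCast_zsmul _ _
  intCast_negSucc_ofNat n := negSucc_zsmul _ _

instance (M : C) : DirectSum.GAlgebra k (YonedaPiece M) where
  toFun := (LinearMap.toSpanSingleton k (Ext M M 0) (Ext.mk₀ (𝟙 M))).toAddMonoidHom
  map_one := one_smul k (Ext.mk₀ (𝟙 M) : Ext M M 0)
  map_mul r t := by
    have h : (r * t) • (Ext.mk₀ (𝟙 M) : Ext M M 0) =
        Ext.comp (t • Ext.mk₀ (𝟙 M) : Ext M M 0) (r • Ext.mk₀ (𝟙 M)) (add_zero 0) := by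
      rw [Ext.comp_smul, Ext.smul_comp, Ext.mk₀_id_comp, smul_smul]
    exact congrArg (GradedMonoid.mk 0) h
  commutes := by
    rintro r ⟨i, a⟩
    refine (mk_comp_eq a (r • Ext.mk₀ (𝟙 M) : Ext M M 0) _ (add_zero i)).trans ?_
    refine Eq.trans ?_ (mk_comp_eq (r • Ext.mk₀ (𝟙 M) : Ext M M 0) a (zero_add i) _)
    rw [Ext.comp_smul, Ext.smul_comp, Ext.mk₀_id_comp, Ext.comp_mk₀_id]
  smul_def := by
    rintro r ⟨i, a⟩
    refine Eq.trans ?_ (mk_comp_eq a (r • Ext.mk₀ (𝟙 M) : Ext M M 0) (add_zero i) _)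
    rw [Ext.comp_smul, Ext.comp_mk₀_id]
    rfl

end Yoneda

section ExtAlgebra

variable (k : Type u) [Field k] {s : ℕ} {R : Finset (FreeMonoid (Fin s))}

/-- `E^i(A) = Ext^i_A(k, k)`, over the category of left `A`-modules. -/
abbrev E (hR : DegreesAtLeastTwo R) (i : ℕ) : Type u := YonedaPiece (trivialModule k hR) i

/-- The Yoneda algebra `E(A) = ⨁ Ext^i_A(k, k)`. -/
abbrev YonedaAlgebra (hR : DegreesAtLeastTwo R) : Type u := DirectSum ℕ (E k hR)

end ExtAlgebra

/-! ### Dimensions and growth -/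

/-- The left global dimension of a ring. -/
def leftGlobalDimension (A : Type u) [Ring A] : WithBot ℕ∞ :=
  ⨆ M : ModuleCat.{u} A, projectiveDimension M

/-- The growth exponent `limsup (log d(n) / log n)` of a function `d : ℕ → ℕ`. -/
def growthExponent (d : ℕ → ℕ) : EReal :=
  Filter.limsup (fun n : ℕ => ((Real.log (d n) / Real.log n : ℝ) : EReal)) Filter.atTop

/-- The Gelfand-Kirillov dimension of a locally finite `ℕ`-graded space or algebra `⨁ M i`:
the growth exponent of `dim (M 0 ⊕ ⋯ ⊕ M n)`. -/
def gradedGKDim (k : Type*) [Field k] (M : ℕ → Type*) [∀ i, AddCommGroup (M i)]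
    [∀ i, Module k (M i)] : EReal :=
  growthExponent fun n => ∑ i ∈ Finset.range (n + 1), Module.finrank k (M i)

/-- The ungraded Gelfand-Kirillov dimension of a `k`-algebra: the supremum, over all finite
dimensional subspaces `V`, of the growth exponents of `dim (k + V + ⋯ + V ^ n)`. -/
def algebraGKDim (k : Type*) [Field k] (B : Type*) [Ring B] [Algebra k B] : EReal :=
  ⨆ (V : Submodule k B) (_ : V.FG), growthExponent fun n =>
    Module.finrank k ((1 ⊔ V) ^ n : Submodule k B)

/-- The Hilbert series `∑ dim (M i) t ^ i`. -/
def hilbertSeries (k : Type*) [Field k] (M : ℕ → Type*) [∀ i, AddCommGroup (M i)]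
    [∀ i, Module k (M i)] : PowerSeries ℚ :=
  PowerSeries.mk fun i => (Module.finrank k (M i) : ℚ)

/-- A power series is (the expansion at `0` of) a rational function. -/
def IsRationalSeries (H : PowerSeries ℚ) : Prop :=
  ∃ P Q : Polynomial ℚ, Q.coeff 0 ≠ 0 ∧ (Q : PowerSeries ℚ) * H = (P : PowerSeries ℚ)

/-! ### The CPS graph -/

section Graph

variable (k : Type u) [Field k] {s : ℕ} (R : Finset (FreeMonoid (Fin s)))

/-- The set `𝔄_m`: words `w ∉ I` with `w ⊗ m ∈ I` such that no proper right factor `v` of `w`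
satisfies `v ⊗ m ∈ I`. -/
def annihilatorWords (m : FreeMonoid (Fin s)) : Set (FreeMonoid (Fin s)) :=
  {w | monomial k w ∉ monomialIdeal k R ∧ monomial k (w * m) ∈ monomialIdeal k R ∧
    ∀ u v : FreeMonoid (Fin s), w = u * v → monomial k (v * m) ∈ monomialIdeal k R → u = 1}

/-- The vertex set `𝔊 = ⋃ 𝔊_i`, with `𝔊_0` the letters and `𝔊_{i+1} = ⋃_{m ∈ 𝔊_i} 𝔄_m`. -/
inductive IsVertex : FreeMonoid (Fin s) → Prop
  | letter (a : Fin s) : IsVertex (FreeMonoid.of a)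
  | step {m w : FreeMonoid (Fin s)} : IsVertex m → w ∈ annihilatorWords k R m → IsVertex w

/-- The CPS graph `Γ(A)`, with an edge `m → w` whenever `w ∈ 𝔄_m`. -/
def cpsGraph : Digraph {w : FreeMonoid (Fin s) // IsVertex k R w} where
  Adj m w := (w : FreeMonoid (Fin s)) ∈ annihilatorWords k R m

end Graph

/-! ### Walks, paths and circuits in a directed graph -/

section Digraph

variable {V : Type*} (Γ : Digraph V)

/-- A finite walk, given by its list of vertices. -/
def IsWalk (p : List V) : Prop := p ≠ [] ∧ p.IsChain Γ.Adj

/-- A path is a walk without repeated vertices. -/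
def IsPath (p : List V) : Prop := IsWalk Γ p ∧ p.Nodup

/-- A circuit is a closed walk of positive length whose vertices are distinct apart from the
coincidence of the two ends; the choice of the initial vertex is disregarded. -/
def IsCircuit (c : Cycle V) : Prop := c ≠ Cycle.nil ∧ c.Nodup ∧ c.Chain Γ.Adj

/-- The circuit `c` is contained in the walk `p`: for some choice of its initial vertex `a`, the
closed walk `a, ..., a` around `c` is a block of consecutive vertices of `p`. -/
def ContainsCircuit (p : List V) (c : Cycle V) : Prop :=
  ∃ (a : V) (l : List V), ((a :: l : List V) : Cycle V) = c ∧ (a :: l ++ [a]) <:+: p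

/-- There are two distinct circuits with a common vertex. -/
def HasMeetingCircuits : Prop :=
  ∃ c c' : Cycle V, IsCircuit Γ c ∧ IsCircuit Γ c' ∧ c ≠ c' ∧ ∃ v : V, v ∈ c ∧ v ∈ c'

/-- The largest number of vertices of a path (which is one more than the length of a longest path,
and `0` for the empty graph). -/
def maxPathVertices : ℕ∞ := ⨆ (p : List V) (_ : IsPath Γ p), (p.length : ℕ∞)

/-- The largest number of distinct circuits contained in a walk. -/
def maxCircuitsInWalk : ℕ∞ :=
  ⨆ (p : List V) (_ : IsWalk Γ p), {c : Cycle V | IsCircuit Γ c ∧ ContainsCircuit p c}.encard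

end Digraph

end CPS

end

/-! The words outside `I` form a `k`-basis of `A`, and this lets free resolutions be built from
words alone. Call a module presented by generators `g j` and sets of words `S j` if the products `φ
b • g j` with `b ∉ S j` form a basis, while those with `b ∈ S j` reduce to basis elements of smaller
weight. By `IsPresentation.syzygy` the kernel of the free cover is presented in the same way: it has
one generator for each word `a` minimal in some `S j`, and the set attached to it is `{b | b * a ∈
I}`. The minimal words of that set are exactly `𝔄_a`, so iterated syzygies follow the edges of
`Γ(A)`.

Every module has such a presentation, coming from a `k`-basis, with the letters as first minimal
words; hence the lengths of walks bound all projective dimensions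
(`IsPresentation.hasProjectiveDimensionLT`). For the trivial module no lower terms occur and the
resolution is minimal, so `dim E^(n+1)` is the number of walks with `n` edges that start at a letter
(`finrank_ext_eq_card`, `finite_rootChain_and_card`).

The rest is counting walks in a finite digraph whose vertices are all reachable from letters.
Without circuits walks are paths, and a circuit gives arbitrarily long walks. When two circuits
meet, some vertex has two successors from which one can return, and applying
`GrowsAtLeast.of_circuit` repeatedly gives growth of every polynomial degree. Otherwise at most one
successor of a vertex leads back to it, a walk passes from circuit to circuit without returning, and
each circuit passed contributes one degree of growth (`growsAtLeast_of_isWalk`,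
`exists_walksUpTo_le`). The generating series of walks solve a linear system with matrix `1 - t B`,
so they are rational by Cramer's rule. The two Gelfand-Kirillov dimensions agree because `E^0`
consists of scalars (`algebraGKDim_eq_gradedGKDim`). -/

noncomputable section

namespace CPS

set_option linter.unusedSectionVars false

/-! ### Presentations of modules by words -/

section Presentation

variable (k : Type*) [Field k] {X : Type*} {A : Type*} [Ring A] [Algebra k A]
  (φ : FreeMonoid X →* A) (I : Set (FreeMonoid X))

/-- The words outside `I` form a basis of `A`, and those in `I` vanish. -/
structure IsMonomialBasis : Prop where
  zero : ∀ w ∈ I, φ w = 0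
  indep : LinearIndependent k (fun w : {w // w ∉ I} => φ w)
  span : ⊤ ≤ Submodule.span k (Set.range fun w : {w // w ∉ I} => φ w)

/-- The minimal words of `S` with respect to right factors, among the words outside `I`. -/
def minimalWords (S : Set (FreeMonoid X)) : Set (FreeMonoid X) :=
  {a | a ∉ I ∧ a ∈ S ∧ ∀ u v, a = u * v → v ∈ S → u = 1}

/-- The words `b` such that `b * a` lies in `I`. -/
def residual (a : FreeMonoid X) : Set (FreeMonoid X) := {b | b * a ∈ I}

/-- The span of the products `φ b • g j`, `b ∉ S j`, of weight less than `n`. -/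
def lowerSpan {J M : Type*} [AddCommGroup M] [Module k M] [Module A M]
    (g : J → M) (S : J → Set (FreeMonoid X)) (d : J → ℕ) (n : ℕ) : Submodule k M :=
  Submodule.span k ((fun p : J × FreeMonoid X => φ p.2 • g p.1) ''
    {p | p.2 ∉ S p.1 ∧ p.2.length + d p.1 < n})

/-- `M` has the `k`-basis `φ b • g j`, `b ∉ S j`, and the products `φ b • g j` with `b ∈ S j` are
combinations of basis elements of smaller weight. -/
structure IsPresentation {J M : Type*} [AddCommGroup M] [Module k M] [Module A M]
    (g : J → M) (S : J → Set (FreeMonoid X)) (d : J → ℕ) : Prop where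
  mul_mem : ∀ j u w, w ∈ S j → u * w ∈ S j
  le : ∀ j, I ⊆ S j
  indep : LinearIndependent k (fun p : (Σ j, {w // w ∉ S j}) => φ p.2 • g p.1)
  span : ⊤ ≤ Submodule.span k (Set.range fun p : (Σ j, {w // w ∉ S j}) => φ p.2 • g p.1)
  lower : ∀ j, ∀ w ∈ S j, φ w • g j ∈ lowerSpan k φ g S d (w.length + d j)

variable {k φ I}

/-- A word outside `I` is a basis element, hence nonzero in `A`, whereas `φ (u * w * v)` has the
factor `φ w = 0`. -/
lemma IsMonomialBasis.mul_mem (h : IsMonomialBasis k φ I) (u : FreeMonoid X) {w : FreeMonoid X}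
    (hw : w ∈ I) (v : FreeMonoid X) : u * w * v ∈ I := by
  by_contra hI
  exact h.indep.ne_zero ⟨_, hI⟩ (by simp [h.zero w hw])

/-- Left factors are stripped off as long as the rest stays in `S`; the length decreases, and the
rest stays outside `I` because `I` absorbs products. -/
lemma exists_minimalWords (hI : ∀ u w v, w ∈ I → u * w * v ∈ I)
    (S : Set (FreeMonoid X)) (c : FreeMonoid X) (hc : c ∈ S) (hcI : c ∉ I) :
    ∃ b, ∃ a ∈ minimalWords I S, c = b * a := by
  induction hn : c.length using Nat.strong_induction_on generalizing c with
  | _ n ih =>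
    by_cases hm : c ∈ minimalWords I S
    · exact ⟨1, c, hm, (one_mul c).symm⟩
    · simp only [minimalWords, Set.mem_ofPred_eq, not_and, not_forall] at hm
      obtain ⟨u, v, huv, hv, hu⟩ := hm hcI hc
      have hlen : c.length = u.length + v.length := by rw [huv, FreeMonoid.length_mul]
      have hu' : u.length ≠ 0 := fun h => hu (FreeMonoid.length_eq_zero.1 h)
      obtain ⟨b, a, ha, hba⟩ := ih v.length (by omega) v hv
        (fun h => hcI (by simpa [huv] using hI u v 1 h)) rfl
      exact ⟨u * b, a, ha, by rw [huv, hba, mul_assoc]⟩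

/-- Of two right factors of the same word one is a right factor of the other, and minimality of the
longer one forces equality. -/
lemma minimalWords_unique (S : Set (FreeMonoid X)) {b b' a a' : FreeMonoid X}
    (ha : a ∈ minimalWords I S) (ha' : a' ∈ minimalWords I S) (h : b * a = b' * a') :
    b = b' ∧ a = a' := by
  have key : ∀ {b b' a a' : FreeMonoid X}, a ∈ minimalWords I S → a' ∈ minimalWords I S →
      b * a = b' * a' → b.length ≤ b'.length → b = b' ∧ a = a' := by
    intro b b' a a' ha ha' h hle
    have hp : b.toList ++ a.toList = b'.toList ++ a'.toList := congrArg FreeMonoid.toList h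
    obtain ⟨c, hc1, hc2⟩ : ∃ c, b' = b * c ∧ a = c * a' := by
      rcases List.append_eq_append_iff.1 hp with ⟨c, h1, h2⟩ | ⟨c, h1, h2⟩
      · exact ⟨FreeMonoid.ofList c, h1, h2⟩
      · have h3 : c = [] := by
          have h4 : b.toList.length ≤ b'.toList.length := hle
          rw [h1, List.length_append] at h4
          exact List.length_eq_zero_iff.1 (by omega)
        subst h3
        exact ⟨1, by simpa using h1.symm, by simpa using h2.symm⟩
    have h1 : c = 1 := ha.2.2 c a' hc2 ha'.2.1
    subst h1
    exact ⟨by simpa using hc1.symm, by simpa using hc2⟩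
  rcases le_total b.length b'.length with hle | hle
  · exact key ha ha' h hle
  · obtain ⟨h1, h2⟩ := key ha' ha h.symm hle
    exact ⟨h1.symm, h2.symm⟩

/-! ### The weight filtration. -/

section Lower

variable {J M : Type*} [AddCommGroup M] [Module k M] [Module A M]

lemma smul_mem_lowerSpan {g : J → M} {S : J → Set (FreeMonoid X)} {d : J → ℕ} {n : ℕ} {j : J}
    {w : FreeMonoid X} (hw : w ∉ S j) (hn : w.length + d j < n) :
    φ w • g j ∈ lowerSpan k φ g S d n :=
  Submodule.subset_span ⟨(j, w), ⟨hw, hn⟩, rfl⟩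

lemma lowerSpan_mono (g : J → M) (S : J → Set (FreeMonoid X)) (d : J → ℕ) {m n : ℕ} (h : m ≤ n) :
    lowerSpan k φ g S d m ≤ lowerSpan k φ g S d n :=
  Submodule.span_mono (Set.image_mono fun _ hp => ⟨hp.1, hp.2.trans_le h⟩)

lemma lowerSpan_anti (g : J → M) {S S' : J → Set (FreeMonoid X)} (h : ∀ j, S j ⊆ S' j) (d : J → ℕ)
    (n : ℕ) : lowerSpan k φ g S' d n ≤ lowerSpan k φ g S d n :=
  Submodule.span_mono (Set.image_mono fun _ hp => ⟨fun hS => hp.1 (h _ hS), hp.2⟩)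

lemma lowerSpan_zero (g : J → M) (S : J → Set (FreeMonoid X)) (d : J → ℕ) :
    lowerSpan k φ g S d 0 = ⊥ := by
  simp [lowerSpan]

lemma lowerSpan_le_span (g : J → M) (S : J → Set (FreeMonoid X)) (d : J → ℕ) (n : ℕ) :
    lowerSpan k φ g S d n ≤
      Submodule.span k (Set.range fun p : (Σ j, {w // w ∉ S j}) => φ p.2 • g p.1) := by
  refine Submodule.span_mono ?_
  rintro _ ⟨⟨j, w⟩, hp, rfl⟩
  exact ⟨⟨j, w, hp.1⟩, rfl⟩

lemma IsPresentation.exists_mem_lowerSpan {g : J → M} {S : J → Set (FreeMonoid X)} {d : J → ℕ}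
    (h : IsPresentation k φ I g S d) (x : M) : ∃ n, x ∈ lowerSpan k φ g S d n := by
  induction h.span (Submodule.mem_top (x := x)) using Submodule.span_induction with
  | mem x hx =>
    obtain ⟨⟨j, w, hw⟩, rfl⟩ := hx
    exact ⟨_, smul_mem_lowerSpan hw (Nat.lt_succ_self _)⟩
  | zero => exact ⟨0, Submodule.zero_mem _⟩
  | add x y _ _ hx hy =>
    obtain ⟨m, hm⟩ := hx
    obtain ⟨n, hn⟩ := hy
    exact ⟨max m n, add_mem (lowerSpan_mono _ _ _ (le_max_left m n) hm)
      (lowerSpan_mono _ _ _ (le_max_right m n) hn)⟩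
  | smul a x _ hx =>
    obtain ⟨m, hm⟩ := hx
    exact ⟨m, Submodule.smul_mem _ _ hm⟩

end Lower

/-! ### Free modules as presented modules. -/

section Free

variable {J : Type*}

lemma IsMonomialBasis.isPresentation_free (h : IsMonomialBasis k φ I) (d : J → ℕ) :
    IsPresentation k φ I (fun j : J => (Finsupp.single j 1 : J →₀ A)) (fun _ => I) d := by
  have hb : ∀ p : (Σ _ : J, {w // w ∉ I}), Finsupp.basis
      (fun _ : J => Module.Basis.mk h.indep h.span) p =
        φ p.2 • (Finsupp.single p.1 1 : J →₀ A) := by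
    rintro ⟨j, w⟩
    simp
  have hb' := funext hb
  refine ⟨fun _ u w hw => ?_, fun _ => subset_rfl, ?_, ?_, fun j w hw => ?_⟩
  · simpa using h.mul_mem u hw 1
  · rw [← hb']; exact Module.Basis.linearIndependent _
  · rw [← hb']; exact (Module.Basis.span_eq _).ge
  · simp [h.zero w hw]

lemma IsMonomialBasis.smul_mem_lowerSpan_free (h : IsMonomialBasis k φ I) (d : J → ℕ)
    (b : FreeMonoid X) {n : ℕ} {x : J →₀ A}
    (hx : x ∈ lowerSpan k φ (fun j : J => (Finsupp.single j 1 : J →₀ A)) (fun _ => I) d n) :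
    φ b • x ∈ lowerSpan k φ (fun j : J => (Finsupp.single j 1 : J →₀ A)) (fun _ => I) d
      (b.length + n) := by
  induction hx using Submodule.span_induction with
  | mem x hx =>
    obtain ⟨⟨j, w⟩, ⟨h1, h2⟩, rfl⟩ := hx
    simp only [smul_smul, ← map_mul] at h2 ⊢
    by_cases hw : b * w ∈ I
    · simp [h.zero _ hw]
    · exact smul_mem_lowerSpan (j := j) hw (by rw [FreeMonoid.length_mul]; omega)
  | zero => simp
  | add x y _ _ hx hy => rw [smul_add]; exact add_mem hx hy
  | smul a x _ hx => rw [smul_comm]; exact Submodule.smul_mem _ _ hx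

end Free

end Presentation

/-! ### The syzygy of a presentation -/

section Syzygy

variable {k : Type*} [Field k] {X : Type*} {A : Type*} [Ring A] [Algebra k A]
  {φ : FreeMonoid X →* A} {I : Set (FreeMonoid X)}
  {J M : Type*} [AddCommGroup M] [Module k M] [Module A M] [IsScalarTower k A M]
  {g : J → M} {S : J → Set (FreeMonoid X)} {d : J → ℕ}

/-- The index type of the generators of the syzygy. -/
abbrev SyzygyIndex (I : Set (FreeMonoid X)) (S : J → Set (FreeMonoid X)) : Type _ :=
  Σ j, minimalWords I (S j)

/-- The generators of the syzygy: a minimal word times a generator, minus a lower term. -/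
def syzygyVector (φ : FreeMonoid X →* A) (low : SyzygyIndex I S → (J →₀ A))
    (p : SyzygyIndex I S) : J →₀ A :=
  φ p.2 • Finsupp.single p.1 1 - low p

section

variable (h : IsPresentation k φ I g S d) (hφ : IsMonomialBasis k φ I)
  (low : SyzygyIndex I S → (J →₀ A))
  (hlow : ∀ p, low p ∈ lowerSpan k φ (fun j : J => (Finsupp.single j 1 : J →₀ A)) S d
    ((p.2 : FreeMonoid X).length + d p.1))

include h in
lemma lowerSpan_le_free (n : ℕ) :
    lowerSpan k φ (fun j : J => (Finsupp.single j 1 : J →₀ A)) S d n ≤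
      lowerSpan k φ (fun j : J => (Finsupp.single j 1 : J →₀ A)) (fun _ => I) d n :=
  lowerSpan_anti _ h.le _ _

include h hφ hlow

lemma smul_low_mem (p : SyzygyIndex I S) (b : FreeMonoid X) :
    φ b • low p ∈ lowerSpan k φ (fun j : J => (Finsupp.single j 1 : J →₀ A)) (fun _ => I) d
      ((b * p.2).length + d p.1) := by
  rw [FreeMonoid.length_mul, add_assoc]
  exact hφ.smul_mem_lowerSpan_free d b (lowerSpan_le_free h _ (hlow p))

/-- A division algorithm: a basis element whose word lies in `S j` factors as `b * a` with `a`
minimal, and is a multiple of the syzygy of `a` plus a term of smaller weight, which is reduced by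
induction. The remainder involves only words outside the `S j`. -/
lemma lowerSpan_free_le (n : ℕ) :
    lowerSpan k φ (fun j : J => (Finsupp.single j 1 : J →₀ A)) (fun _ => I) d n ≤
      lowerSpan k φ (syzygyVector φ low) (fun p => residual I p.2)
        (fun p => (p.2 : FreeMonoid X).length + d p.1) n ⊔
      lowerSpan k φ (fun j : J => (Finsupp.single j 1 : J →₀ A)) S d n := by
  induction n using Nat.strong_induction_on with
  | _ n ih =>
    refine Submodule.span_le.2 ?_
    rintro _ ⟨⟨j, c⟩, ⟨hc, hn⟩, rfl⟩
    simp only at hc hn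
    by_cases hS : c ∈ S j
    · obtain ⟨b, a, ha, rfl⟩ := exists_minimalWords (fun u w v hw => hφ.mul_mem u hw v) (S j) c hS hc
      have e : φ (b * a) • (Finsupp.single j 1 : J →₀ A) =
          φ b • syzygyVector φ low ⟨j, a, ha⟩ + φ b • low ⟨j, a, ha⟩ := by
        rw [syzygyVector, smul_sub, sub_add_cancel, smul_smul, map_mul]
      simp only [e]
      refine add_mem (Submodule.mem_sup_left (smul_mem_lowerSpan (S := fun p : SyzygyIndex I S =>
        residual I (p.2 : FreeMonoid X)) hc ?_)) ?_
      · simpa [FreeMonoid.length_mul, add_assoc] using hn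
      · have := ih _ hn (smul_low_mem h hφ low hlow ⟨j, a, ha⟩ b)
        have hle := sup_le_sup
          (lowerSpan_mono (k := k) (φ := φ) (syzygyVector φ low)
            (fun p => residual I (p.2 : FreeMonoid X))
            (fun p => (p.2 : FreeMonoid X).length + d p.1) hn.le)
          (lowerSpan_mono (k := k) (φ := φ) (fun j : J => (Finsupp.single j 1 : J →₀ A)) S d hn.le)
        exact hle this
    · exact Submodule.mem_sup_right (smul_mem_lowerSpan hS hn)

/-- The products in question have pairwise distinct leading terms `(b * a) e_j`, by uniqueness of
the factorisation. A unitriangular endomorphism carries these leading terms to the products, so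
independence is inherited from the monomial basis. -/
lemma linearIndependent_syzygyVector :
    LinearIndependent k (fun p : (Σ p : SyzygyIndex I S, {w // w ∉ residual I (p.2 : FreeMonoid X)}) =>
      φ p.2 • syzygyVector φ low p.1) := by
  classical
  have hI := fun u w v (hw : w ∈ I) => hφ.mul_mem u hw v
  have hP := hφ.isPresentation_free d
  let e : J → (J →₀ A) := fun j => Finsupp.single j 1
  let β : Module.Basis (Σ _ : J, {w // w ∉ I}) k (J →₀ A) := Module.Basis.mk hP.indep hP.span
  have hβ : ∀ p, β p = φ p.2 • e p.1 := fun p => Module.Basis.mk_apply _ _ _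
  have hsplit : ∀ p : (Σ _ : J, {w // w ∉ I}), (p.2 : FreeMonoid X) ∈ S p.1 →
      ∃ q : FreeMonoid X × minimalWords I (S p.1), (p.2 : FreeMonoid X) = q.1 * q.2 := by
    intro p hp
    obtain ⟨b, a, ha, hab⟩ := exists_minimalWords hI (S p.1) p.2 hp p.2.2
    exact ⟨(b, ⟨a, ha⟩), hab⟩
  choose q hq using hsplit
  -- `Φ` sends a leading term to the syzygy multiple that it leads and fixes the remaining basis
  -- elements. It differs from the identity by terms of strictly smaller weight.
  let Φ : (J →₀ A) →ₗ[k] (J →₀ A) := β.constr k fun p =>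
    if hp : (p.2 : FreeMonoid X) ∈ S p.1 then
      φ (q p hp).1 • syzygyVector φ low ⟨p.1, (q p hp).2⟩ else φ p.2 • e p.1
  have hΦ : ∀ n, ∀ x ∈ lowerSpan k φ e (fun _ => I) d (n + 1),
      x - Φ x ∈ lowerSpan k φ e (fun _ => I) d n := by
    intro n x hx
    induction hx using Submodule.span_induction with
    | mem x hx =>
      obtain ⟨⟨j, w⟩, ⟨h1, h2⟩, rfl⟩ := hx
      have h3 := β.constr_basis k (fun p =>
        if hp : (p.2 : FreeMonoid X) ∈ S p.1 then
        φ (q p hp).1 • syzygyVector φ low ⟨p.1, (q p hp).2⟩ else φ p.2 • e p.1) ⟨j, w, h1⟩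
      simp only [hβ] at h3
      simp only [Φ, h3]
      split_ifs with hp
      · have h4 := hq ⟨j, w, h1⟩ hp
        have h5 := smul_low_mem h hφ low hlow ⟨j, (q ⟨j, w, h1⟩ hp).2⟩ (q ⟨j, w, h1⟩ hp).1
        simp only at h4
        rw [← h4] at h5
        rw [syzygyVector, smul_sub, smul_smul, ← map_mul]
        simp only
        rw [← h4, sub_sub_cancel]
        exact lowerSpan_mono _ _ _ (Nat.lt_succ_iff.1 h2) h5
      · simp
    | zero => simp
    | add x y _ _ hx hy =>
      rw [map_add, add_sub_add_comm]
      exact add_mem hx hy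
    | smul a x _ hx => rw [map_smul, ← smul_sub]; exact Submodule.smul_mem _ _ hx
  have hinj : LinearMap.ker Φ = ⊥ := by
    refine LinearMap.ker_eq_bot'.2 fun x hx => ?_
    -- For `x` in the kernel `x = x - Φ x`, so its weight bound drops step by step to `0`.
    have key : ∀ n, x ∈ lowerSpan k φ e (fun _ => I) d n → x = 0 := by
      intro n
      induction n with
      | zero => intro hn; rwa [lowerSpan_zero, Submodule.mem_bot] at hn
      | succ n ih => intro hn; exact ih (by simpa [hx] using hΦ n x hn)
    obtain ⟨n, hn⟩ := hP.exists_mem_lowerSpan x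
    exact key n hn
  let f : (Σ p : SyzygyIndex I S, {w // w ∉ residual I (p.2 : FreeMonoid X)}) →
      (Σ _ : J, {w // w ∉ I}) := fun p => ⟨p.1.1, p.2 * p.1.2, p.2.2⟩
  have hf : Function.Injective f := by
    rintro ⟨⟨j, a, ha⟩, b, hb⟩ ⟨⟨j', a', ha'⟩, b', hb'⟩ hpq
    obtain ⟨rfl, h2⟩ := Sigma.mk.inj_iff.1 hpq
    obtain ⟨rfl, rfl⟩ := minimalWords_unique (S j) ha ha' (Subtype.ext_iff.1 (eq_of_heq h2))
    rfl
  have hli := (β.linearIndependent.map' Φ hinj).comp f hf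
  suffices hfun : (fun p : (Σ p : SyzygyIndex I S, {w // w ∉ residual I (p.2 : FreeMonoid X)}) =>
      φ p.2 • syzygyVector φ low p.1) = (Φ ∘ β) ∘ f by
    rw [hfun]
    exact hli
  ext1 ⟨⟨j, a, ha⟩, b, hb⟩
  have hmem : b * a ∈ S j := h.mul_mem j b a ha.2.1
  have hq' := hq ⟨j, b * a, hb⟩ hmem
  obtain ⟨h1, h2⟩ := minimalWords_unique (S j) ha (q ⟨j, b * a, hb⟩ hmem).2.2 hq'
  simp only [Function.comp, f, Φ, β.constr_basis, dif_pos hmem]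
  rw [← h1]
  congr 3
  exact Subtype.ext h2

end

variable (h : IsPresentation k φ I g S d) (hφ : IsMonomialBasis k φ I)
  (low : SyzygyIndex I S → (J →₀ A))
  (hlow : ∀ p, low p ∈ lowerSpan k φ (fun j : J => (Finsupp.single j 1 : J →₀ A)) S d
    ((p.2 : FreeMonoid X).length + d p.1))
  (hlow' : ∀ p, Finsupp.linearCombination A g (low p) = φ p.2 • g p.1)

/-- The generators of the syzygy. -/
def syzygyGen (p : SyzygyIndex I S) : LinearMap.ker (Finsupp.linearCombination A g) :=
  ⟨syzygyVector φ low p, by simp [syzygyVector, hlow']⟩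

-- The basis elements of the free module with words outside `S j` map to the basis of `M`. This is
-- why a remainder of the division vanishes once it is a syzygy.
include h in
lemma eq_zero_of_mem_lowerSpan {n : ℕ} {x : J →₀ A}
    (hx : x ∈ lowerSpan k φ (fun j : J => (Finsupp.single j 1 : J →₀ A)) S d n)
    (hx0 : Finsupp.linearCombination A g x = 0) : x = 0 := by
  have hx' := lowerSpan_le_span _ _ _ _ hx
  obtain ⟨c, rfl⟩ := (Finsupp.mem_span_range_iff_exists_finsupp).1 hx'
  have : Finsupp.linearCombination k
      (fun p : (Σ j, {w // w ∉ S j}) => φ p.2 • g p.1) c = 0 := by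
    rw [← hx0, Finsupp.linearCombination_apply, Finsupp.sum, Finsupp.sum, map_sum]
    refine Finset.sum_congr rfl fun p _ => ?_
    rw [LinearMap.map_smul_of_tower, map_smul]
    simp
  rw [linearIndependent_iff.1 h.indep c this]
  simp

-- Division of a syzygy leaves a remainder that is itself a syzygy, hence zero; the division does
-- not raise the weight bound, so generation comes with control of weights.
include h hφ hlow in
lemma syzygy_lower (n : ℕ) (x : LinearMap.ker (Finsupp.linearCombination A g))
    (hx : (x : J →₀ A) ∈
      lowerSpan k φ (fun j : J => (Finsupp.single j 1 : J →₀ A)) (fun _ => I) d n) :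
    x ∈ lowerSpan k φ (syzygyGen low hlow') (fun p => residual I p.2)
      (fun p => (p.2 : FreeMonoid X).length + d p.1) n := by
  have hmap : (lowerSpan k φ (syzygyGen low hlow') (fun p => residual I p.2)
      (fun p => (p.2 : FreeMonoid X).length + d p.1) n).map
        ((LinearMap.ker (Finsupp.linearCombination A g)).subtype.restrictScalars k) =
      lowerSpan k φ (syzygyVector φ low) (fun p => residual I p.2)
        (fun p => (p.2 : FreeMonoid X).length + d p.1) n := by
    rw [lowerSpan, Submodule.map_span, lowerSpan, ← Set.image_comp]
    rfl
  obtain ⟨y, hy, z, hz, hyz⟩ := Submodule.mem_sup.1 (lowerSpan_free_le h hφ low hlow n hx)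
  rw [← hmap] at hy
  obtain ⟨y', hy', rfl⟩ := hy
  have hz0 : z = 0 := by
    refine eq_zero_of_mem_lowerSpan h hz ?_
    have h1 := x.2
    have h2 := y'.2
    rw [LinearMap.mem_ker] at h1 h2
    rw [← hyz, map_add] at h1
    simpa [h2] using h1
  have : x = y' := Subtype.ext (by simpa [hz0] using hyz.symm)
  rwa [this]

include h hφ hlow in
/-- The syzygy of a presentation is presented by the minimal words. -/
theorem IsPresentation.syzygy :
    IsPresentation k φ I (syzygyGen low hlow') (fun p => residual I p.2)
      (fun p => (p.2 : FreeMonoid X).length + d p.1) := by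
  have hI := fun u w v (hw : w ∈ I) => hφ.mul_mem u hw v
  refine ⟨fun p u w hw => ?_, fun p w hw => ?_, ?_, fun x _ => ?_, fun p b hb => ?_⟩
  · simpa [residual, mul_assoc] using hI u _ 1 hw
  · simpa [residual] using hI 1 w p.2 hw
  · exact LinearIndependent.of_comp
      ((LinearMap.ker (Finsupp.linearCombination A g)).subtype.restrictScalars k)
      (linearIndependent_syzygyVector h hφ low hlow)
  · obtain ⟨n, hn⟩ := (hφ.isPresentation_free d).exists_mem_lowerSpan (x : J →₀ A)
    exact lowerSpan_le_span _ _ _ _ (syzygy_lower h hφ low hlow hlow' n x hn)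
  -- Since `b * a ∈ I`, the leading term is killed and only `-φ b • low` survives, which has smaller
  -- weight.
  · refine syzygy_lower h hφ low hlow hlow' _ _ ?_
    have h1 : ((φ b • syzygyGen low hlow' p : LinearMap.ker (Finsupp.linearCombination A g)) :
        J →₀ A) = - (φ b • low p) := by
      change φ b • syzygyVector φ low p = _
      rw [syzygyVector, smul_sub, smul_smul, ← map_mul, hφ.zero _ hb, zero_smul, zero_sub]
    rw [h1, ← add_assoc, ← FreeMonoid.length_mul]
    exact neg_mem (smul_low_mem h hφ low hlow p b)

include h in
lemma IsPresentation.surjective :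
    Function.Surjective (Finsupp.linearCombination A g) := by
  intro x
  have hle : Submodule.span k (Set.range fun p : (Σ j, {w // w ∉ S j}) => φ p.2 • g p.1) ≤
      LinearMap.range ((Finsupp.linearCombination A g).restrictScalars k) := by
    refine Submodule.span_le.2 ?_
    rintro _ ⟨p, rfl⟩
    exact ⟨Finsupp.single p.1 (φ p.2), by simp⟩
  exact hle (h.span (Submodule.mem_top (x := x)))

-- The lower terms of `M` lift, with the same weights, because the free cover matches the two
-- spanning families of products.
include h in
lemma IsPresentation.exists_low :
    ∃ low : SyzygyIndex I S → (J →₀ A),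
      (∀ p, low p ∈ lowerSpan k φ (fun j : J => (Finsupp.single j 1 : J →₀ A)) S d
        ((p.2 : FreeMonoid X).length + d p.1)) ∧
      ∀ p, Finsupp.linearCombination A g (low p) = φ p.2 • g p.1 := by
  have hmap : ∀ n, (lowerSpan k φ (fun j : J => (Finsupp.single j 1 : J →₀ A)) S d n).map
      ((Finsupp.linearCombination A g).restrictScalars k) = lowerSpan k φ g S d n := by
    intro n
    rw [lowerSpan, Submodule.map_span, lowerSpan, ← Set.image_comp]
    congr 2
    ext p
    simp
  have key : ∀ p : SyzygyIndex I S, ∃ x,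
      x ∈ lowerSpan k φ (fun j : J => (Finsupp.single j 1 : J →₀ A)) S d
        ((p.2 : FreeMonoid X).length + d p.1) ∧
      Finsupp.linearCombination A g x = φ p.2 • g p.1 := by
    intro p
    have hp := h.lower p.1 p.2 p.2.2.2.1
    rw [← hmap] at hp
    obtain ⟨x, hx, hx'⟩ := hp
    exact ⟨x, hx, hx'⟩
  choose low h1 h2 using key
  exact ⟨low, h1, h2⟩

end Syzygy

/-! ### Projective dimension and `Ext` from a presentation -/

section Homological

open scoped ModuleCat

/-- Chains `a_1, ..., a_n` of words, where `a_1` is minimal in `S` and `a_{i+1}` is minimal among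
the words annihilating `a_i` from the left. -/
def Chain {X : Type} (I : Set (FreeMonoid X)) : ℕ → Set (FreeMonoid X) → Type
  | 0, _ => Unit
  | n + 1, S => Σ a : minimalWords I S, Chain I n (residual I a)

variable {k : Type u} [Field k] {X : Type} {A : Type u} [Ring A] [Algebra k A]
  {φ : FreeMonoid X →* A} {I : Set (FreeMonoid X)}

lemma syzygy_shortExact {J M : Type u} [AddCommGroup M] [Module k M] [Module A M]
    [IsScalarTower k A M] {g : J → M} {S : J → Set (FreeMonoid X)} {d : J → ℕ}
    (h : IsPresentation k φ I g S d) :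
    (Finsupp.linearCombination A g).shortComplexKer.ShortExact :=
  LinearMap.shortExact_shortComplexKer h.surjective

/-- A chain of length `n + 1` for `M` is a minimal word followed by a chain of length `n` for the
corresponding generator of the syzygy. After `n` syzygies no generators are left. -/
theorem IsPresentation.hasProjectiveDimensionLT (hφ : IsMonomialBasis k φ I) (n : ℕ) :
    ∀ {J M : Type u} [AddCommGroup M] [Module k M] [Module A M] [IsScalarTower k A M]
      {g : J → M} {S : J → Set (FreeMonoid X)} {d : J → ℕ},
      IsPresentation k φ I g S d → (∀ j, IsEmpty (Chain I n (S j))) →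
      HasProjectiveDimensionLT (ModuleCat.of A M) n := by
  induction n with
  | zero =>
    intro J M _ _ _ _ g S d h hS
    have : IsEmpty J := ⟨fun j => (hS j).false ()⟩
    have hs : Subsingleton M := by
      refine ⟨fun x y => ?_⟩
      obtain ⟨x', rfl⟩ := h.surjective x
      obtain ⟨y', rfl⟩ := h.surjective y
      rw [Subsingleton.elim x' y']
    exact (ModuleCat.isZero_of_subsingleton (ModuleCat.of A M)).hasProjectiveDimensionLT_zero
  | succ n ih =>
    intro J M _ _ _ _ g S d h hS
    obtain ⟨low, hlow, hlow'⟩ := h.exists_low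
    have hK := ih (h.syzygy hφ low hlow hlow')
      (fun p => ⟨fun c => (hS p.1).false ⟨p.2, c⟩⟩)
    have hP : Projective (ModuleCat.of A (J →₀ A)) :=
      ModuleCat.projective_of_free Finsupp.basisSingleOne
    have hP' : HasProjectiveDimensionLT (ModuleCat.of A (J →₀ A)) (n + 1) :=
      hasProjectiveDimensionLT_of_ge _ 1 (n + 1) (by omega)
    exact (syzygy_shortExact h).hasProjectiveDimensionLT_X₃ n hK hP'

/-- Any module is presented by a `k`-basis, all nonempty words lowering the weight. -/
lemma isPresentation_basis {J M : Type*} [AddCommGroup M] [Module k M] [Module A M]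
    (hI : (1 : FreeMonoid X) ∉ I) (hI' : ∀ u v : FreeMonoid X, u * v = 1 → v = 1)
    (b : Module.Basis J k M) :
    IsPresentation k φ I b (fun _ => {w | w ≠ 1}) (fun _ => 0) := by
  have h1 : ∀ p : (Σ _ : J, {w : FreeMonoid X // w ∉ {w | w ≠ 1}}), φ p.2 • b p.1 = b p.1 := by
    rintro ⟨j, w, hw⟩
    have : w = 1 := by simpa using hw
    simp [this]
  refine ⟨fun j u w hw h => hw (hI' u w h), fun j w hw h => hI (h ▸ hw), ?_, ?_, ?_⟩
  · rw [funext h1]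
    refine b.linearIndependent.comp Sigma.fst ?_
    rintro ⟨j, w, hw⟩ ⟨j', w', hw'⟩ rfl
    have e1 : w = 1 := by simpa using hw
    have e2 : w' = 1 := by simpa using hw'
    subst e1 e2
    rfl
  · rw [funext h1, ← b.span_eq]
    refine Submodule.span_mono ?_
    rintro _ ⟨j, rfl⟩
    exact ⟨⟨j, 1, by simp⟩, rfl⟩
  · intro j w hw
    have hlen : w.length ≠ 0 := fun h => hw (FreeMonoid.length_eq_zero.1 h)
    -- All basis vectors have weight `0`, so they all lie below the weight of a nonempty word.
    have hle : Submodule.span k (Set.range b) ≤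
        lowerSpan k φ b (fun _ => {w | w ≠ 1}) (fun _ => 0) (w.length + 0) := by
      refine Submodule.span_mono ?_
      rintro _ ⟨i, rfl⟩
      refine ⟨(i, 1), ⟨by simp, ?_⟩, by simp⟩
      simp only [FreeMonoid.length_one]
      omega
    exact hle (by rw [b.span_eq]; trivial)

/-- The words in `S j` kill the generator `g j`. -/
def IsStrict {J M : Type*} [AddCommGroup M] [Module A M] (φ : FreeMonoid X →* A)
    (g : J → M) (S : J → Set (FreeMonoid X)) : Prop :=
  ∀ j, ∀ w ∈ S j, φ w • g j = 0

/-- Only degree `0` needs the hypothesis, since `Ext` from a projective vanishes in positive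
degrees. -/
lemma precomp_eq_zero {P K N : ModuleCat.{u} A} [Projective P] (f : K ⟶ P)
    (hf : ∀ e : P ⟶ N, f ≫ e = 0) (n : ℕ) (x : Ext P N n) :
    (Ext.mk₀ f).comp x (zero_add n) = 0 := by
  cases n with
  | zero =>
    obtain ⟨e, rfl⟩ := Ext.addEquiv₀.symm.surjective x
    simp [hf]
  | succ n => rw [Ext.eq_zero_of_projective x, Ext.comp_zero]

lemma IsStrict.isPresentation_low {J M : Type*} [AddCommGroup M] [Module k M] [Module A M]
    {g : J → M} {S : J → Set (FreeMonoid X)} (hs : IsStrict φ g S) (d : J → ℕ) :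
    (∀ p : SyzygyIndex I S, (0 : SyzygyIndex I S → (J →₀ A)) p ∈ lowerSpan k φ
      (fun j : J => (Finsupp.single j 1 : J →₀ A)) S d ((p.2 : FreeMonoid X).length + d p.1)) ∧
    ∀ p : SyzygyIndex I S, Finsupp.linearCombination A g
      ((0 : SyzygyIndex I S → (J →₀ A)) p) = φ p.2 • g p.1 :=
  ⟨fun _ => Submodule.zero_mem _, fun p => by
    rw [Pi.zero_apply, map_zero, hs p.1 p.2 p.2.2.2.1]⟩

/-- A linear map to a module killed by the nonempty words vanishes on the syzygy of a strict
presentation. -/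
lemma IsPresentation.apply_eq_zero_of_mem_ker (hφ : IsMonomialBasis k φ I)
    {J M : Type*} [AddCommGroup M] [Module k M] [Module A M] [IsScalarTower k A M]
    {g : J → M} {S : J → Set (FreeMonoid X)} {d : J → ℕ} (h : IsPresentation k φ I g S d)
    (hs : IsStrict φ g S) (h1 : ∀ j, 1 ∉ S j) {N : Type*} [AddCommGroup N] [Module k N]
    [Module A N] [IsScalarTower k A N] (hN : ∀ w : FreeMonoid X, w ≠ 1 → ∀ x : N, φ w • x = 0)
    (e : (J →₀ A) →ₗ[A] N) (x : LinearMap.ker (Finsupp.linearCombination A g)) : e x = 0 := by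
  obtain ⟨hlow, hlow'⟩ := hs.isPresentation_low (k := k) (I := I) d
  have hle : (⊤ : Submodule k (LinearMap.ker (Finsupp.linearCombination A g))) ≤
      LinearMap.ker ((e.restrictScalars k) ∘ₗ
        ((LinearMap.ker (Finsupp.linearCombination A g)).subtype.restrictScalars k)) := by
    refine (h.syzygy hφ 0 hlow hlow').span.trans (Submodule.span_le.2 ?_)
    rintro _ ⟨p, rfl⟩
    have hp : (p.1.2 : FreeMonoid X) ≠ 1 := fun hp => h1 p.1.1 (hp ▸ p.1.2.2.2.1)
    change e (φ p.2 • syzygyVector φ 0 p.1) = 0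
    rw [syzygyVector, Pi.zero_apply, sub_zero, map_smul, map_smul, hN _ hp, smul_zero]
  exact hle (Submodule.mem_top (x := x))

/-- Maps from the free cover to `N` vanish on the syzygy, whose spanning elements involve only
nonempty words. The long exact sequence therefore splits into isomorphisms: `Ext^0` is that of the
free cover, giving one copy of `N` for each generator, and `Ext^(n+1)` of the module is `Ext^n` of
its syzygy. The syzygy satisfies the hypotheses again, so chains are counted by induction. -/
theorem finrank_ext_eq_card (hφ : IsMonomialBasis k φ I) (N : ModuleCat.{u} A)
    (hN : ∀ w : FreeMonoid X, w ≠ 1 → ∀ x : N, φ w • x = 0) (hN1 : Module.finrank k N = 1) (n : ℕ) :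
    ∀ {J M : Type u} [AddCommGroup M] [Module k M] [Module A M] [IsScalarTower k A M]
      {g : J → M} {S : J → Set (FreeMonoid X)} {d : J → ℕ},
      IsPresentation k φ I g S d → IsStrict φ g S → (∀ j, 1 ∉ S j) →
      (∀ n, Finite (Σ j, Chain I n (S j))) →
      Module.Finite k (Ext (ModuleCat.of A M) N n) ∧
      Module.finrank k (Ext (ModuleCat.of A M) N n) = Nat.card (Σ j, Chain I n (S j)) := by
  have hfN : Module.Finite k N := Module.finite_of_finrank_pos (by omega)
  have hzero : ∀ {J M : Type u} [AddCommGroup M] [Module k M] [Module A M] [IsScalarTower k A M]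
      {g : J → M} {S : J → Set (FreeMonoid X)} {d : J → ℕ}
      (_ : IsPresentation k φ I g S d) (_ : IsStrict φ g S) (_ : ∀ j, 1 ∉ S j) (n : ℕ)
      (x : Ext.{u} (Finsupp.linearCombination A g).shortComplexKer.X₂ N n),
      (Ext.mk₀ (Finsupp.linearCombination A g).shortComplexKer.f).comp x (zero_add n) = 0 := by
    intro J M _ _ _ _ g S d h hs h1 n x
    have hP : Projective (Finsupp.linearCombination A g).shortComplexKer.X₂ :=
      ModuleCat.projective_of_free (M := ModuleCat.of A (J →₀ A)) Finsupp.basisSingleOne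
    refine precomp_eq_zero _ (fun e => ?_) n x
    ext y
    exact h.apply_eq_zero_of_mem_ker hφ hs h1 hN e.hom y
  induction n with
  | zero =>
    intro J M _ _ _ _ g S d h hs h1 hfin
    -- Chains of length `0` are the generators, so the finiteness hypothesis makes `J` finite.
    let eJ : (Σ j, Chain I 0 (S j)) ≃ J :=
      ⟨fun p => p.1, fun j => ⟨j, ()⟩, fun _ => rfl, fun _ => rfl⟩
    have hJ : Finite J := Finite.of_equiv _ eJ
    have hE := syzygy_shortExact h
    let π : Ext (ModuleCat.of A M) N 0 →ₗ[k] Ext (ModuleCat.of A (J →₀ A)) N 0 :=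
      Ext.precompOfLinear (Ext.mk₀ (Finsupp.linearCombination A g).shortComplexKer.g) k N
        (zero_add 0)
    have hπ : Function.Bijective π := by
      have := hE.epi_g
      refine ⟨Ext.precomp_mk₀_injective_of_epi N
        (Finsupp.linearCombination A g).shortComplexKer.g, fun x => ?_⟩
      exact Ext.contravariant_sequence_exact₂ hE N x (hzero h hs h1 0 x)
    let e := (LinearEquiv.ofBijective π hπ).trans <| (Ext.linearEquiv₀ (R := k)).trans <|
      (ModuleCat.homLinearEquiv (S := k)).trans (Finsupp.llift N A k J).symm
    have := Fintype.ofFinite J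
    refine ⟨Module.Finite.equiv e.symm, ?_⟩
    rw [e.finrank_eq, Nat.card_congr eJ, Module.finrank_pi_fintype, Nat.card_eq_fintype_card]
    simp [hN1]
  | succ n ih =>
    intro J M _ _ _ _ g S d h hs h1 hfin
    obtain ⟨hlow, hlow'⟩ := hs.isPresentation_low (k := k) (I := I) d
    have hE := syzygy_shortExact h
    let eS : ∀ n, (Σ p : SyzygyIndex I S, Chain I n (residual I (p.2 : FreeMonoid X))) ≃
      (Σ j, Chain I (n + 1) (S j)) := fun n =>
        Equiv.sigmaAssoc fun j (a : minimalWords I (S j)) => Chain I n (residual I (a : FreeMonoid X))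
    have hK := ih (h.syzygy hφ 0 hlow hlow') (fun p w hw => by
      change φ w • (⟨syzygyVector φ 0 p, _⟩ : LinearMap.ker (Finsupp.linearCombination A g)) = 0
      refine Subtype.ext ?_
      change φ w • syzygyVector φ 0 p = 0
      rw [syzygyVector, Pi.zero_apply, sub_zero, smul_smul, ← map_mul, hφ.zero _ hw, zero_smul])
      -- The empty word kills a generator of the syzygy only if its minimal word lies in `I`, which
      -- is excluded.
      (fun p hp => p.2.2.1 (by simpa [residual] using hp))
      (fun n => Finite.of_equiv _ (eS n).symm)
    let δ : Ext (Finsupp.linearCombination A g).shortComplexKer.X₁ N n →ₗ[k]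
        Ext (ModuleCat.of A M) N (n + 1) :=
      Ext.precompOfLinear hE.extClass k N (add_comm 1 n)
    have hP : Projective (Finsupp.linearCombination A g).shortComplexKer.X₂ :=
      ModuleCat.projective_of_free (M := ModuleCat.of A (J →₀ A)) Finsupp.basisSingleOne
    have hδ : Function.Bijective δ := by
      refine ⟨(injective_iff_map_eq_zero δ).2 fun x hx => ?_, fun x => ?_⟩
      · obtain ⟨y, rfl⟩ := Ext.contravariant_sequence_exact₁ hE N x (add_comm 1 n) hx
        exact hzero h hs h1 n y
      · exact Ext.contravariant_sequence_exact₃ hE N x (Ext.eq_zero_of_projective _) (add_comm 1 n)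
    have e := LinearEquiv.ofBijective δ hδ
    have hK1 : Module.Finite k (Ext (Finsupp.linearCombination A g).shortComplexKer.X₁ N n) := hK.1
    refine ⟨Module.Finite.equiv e, ?_⟩
    rw [← e.finrank_eq, ← Nat.card_congr (eS n)]
    exact hK.2

end Homological

/-! ### The monomial basis of a monomial algebra -/

section MonomialBasis

open scoped Pointwise

variable (k : Type u) [Field k] {s : ℕ} (R : Finset (FreeMonoid (Fin s)))

/-- The words spelling a monomial of the ideal. -/
def zeroWords : Set (FreeMonoid (Fin s)) := {w | monomial k w ∈ monomialIdeal k R}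

/-- The class of a word in the monomial algebra. -/
def word : FreeMonoid (Fin s) →* MonomialAlgebra k R :=
  ((monomialIdeal k R).ringCon.mk' : FreeAlgebra k (Fin s) →* MonomialAlgebra k R).comp
    (FreeMonoid.lift (FreeAlgebra.ι k))

lemma monomial_mul (u v : FreeMonoid (Fin s)) :
    monomial k (u * v) = monomial k u * monomial k v := map_mul _ _ _

lemma basisFreeMonoid_apply (w : FreeMonoid (Fin s)) :
    FreeAlgebra.basisFreeMonoid k (Fin s) w = monomial k w := by
  simp [FreeAlgebra.basisFreeMonoid, monomial]
  simp [FreeAlgebra.equivMonoidAlgebraFreeMonoid]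

/-- The words with a factor in `R`. -/
def factorWords : Set (FreeMonoid (Fin s)) := {w | ∃ r ∈ R, ∃ u v, w = u * r * v}

lemma span_factorWords_mul (x y : FreeAlgebra k (Fin s))
    (hy : y ∈ Submodule.span k (monomial k '' factorWords R)) :
    x * y ∈ Submodule.span k (monomial k '' factorWords R) ∧
    y * x ∈ Submodule.span k (monomial k '' factorWords R) := by
  have hx : x ∈ Submodule.span k (Set.range (monomial k)) := by
    rw [← funext (basisFreeMonoid_apply k), Module.Basis.span_eq]; trivial
  constructor
  · have := Submodule.mul_mem_mul hx hy
    rw [Submodule.span_mul_span] at this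
    refine Submodule.span_mono ?_ this
    rintro _ ⟨_, ⟨a, rfl⟩, _, ⟨b, ⟨r, hr, u, v, rfl⟩, rfl⟩, rfl⟩
    exact ⟨_, ⟨r, hr, a * u, v, by simp only [mul_assoc]⟩, monomial_mul k a _⟩
  · have := Submodule.mul_mem_mul hy hx
    rw [Submodule.span_mul_span] at this
    refine Submodule.span_mono ?_ this
    rintro _ ⟨_, ⟨b, ⟨r, hr, u, v, rfl⟩, rfl⟩, _, ⟨a, rfl⟩, rfl⟩
    exact ⟨_, ⟨r, hr, u, v * a, by simp only [mul_assoc]⟩, monomial_mul k _ a⟩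

/-- The span of the words with a factor in `R` is already a two-sided ideal containing the
generators. -/
lemma mem_span_factorWords {x : FreeAlgebra k (Fin s)} (hx : x ∈ monomialIdeal k R) :
    x ∈ Submodule.span k (monomial k '' factorWords R) := by
  let 𝔟 : TwoSidedIdeal (FreeAlgebra k (Fin s)) :=
    TwoSidedIdeal.mk' (Submodule.span k (monomial k '' factorWords R) : Set _)
      (Submodule.zero_mem _) (fun h h' => Submodule.add_mem _ h h') (fun h => Submodule.neg_mem _ h)
      (fun {x y} h => (span_factorWords_mul k R x y h).1)
      (fun {x y} h => (span_factorWords_mul k R y x h).2)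
  have hle : monomialIdeal k R ≤ 𝔟 := by
    refine TwoSidedIdeal.span_le.2 ?_
    rintro _ ⟨r, hr, rfl⟩
    rw [SetLike.mem_coe, TwoSidedIdeal.mem_mk']
    exact Submodule.subset_span ⟨r, ⟨r, hr, 1, 1, by simp⟩, rfl⟩
  have := hle hx
  rwa [TwoSidedIdeal.mem_mk'] at this

lemma repr_eq_zero_of_mem {x : FreeAlgebra k (Fin s)} (hx : x ∈ monomialIdeal k R)
    {w : FreeMonoid (Fin s)} (hw : w ∉ factorWords R) :
    (FreeAlgebra.basisFreeMonoid k (Fin s)).repr x w = 0 := by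
  have h := mem_span_factorWords k R hx
  rw [← funext (basisFreeMonoid_apply k), Module.Basis.mem_span_image] at h
  by_contra h0
  exact hw (h (Finsupp.mem_support_iff.2 h0))

/-- Membership in the ideal becomes a matter of factors of words: a word without a factor in `R` has
coefficient `1` at itself, while elements of the ideal have coefficient `0` there. -/
lemma zeroWords_eq : zeroWords k R = factorWords R := by
  ext w
  constructor
  · intro hw
    by_contra h
    have := repr_eq_zero_of_mem k R hw h
    rw [← basisFreeMonoid_apply, Module.Basis.repr_self] at this
    simp at this
  · rintro ⟨r, hr, u, v, rfl⟩
    change monomial k _ ∈ monomialIdeal k R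
    rw [monomial_mul, monomial_mul]
    exact TwoSidedIdeal.mul_mem_right _ _ _ (TwoSidedIdeal.mul_mem_left _ _ _
      (TwoSidedIdeal.subset_span ⟨r, hr, rfl⟩))

lemma mk_eq_zero_iff (x : FreeAlgebra k (Fin s)) :
    (monomialIdeal k R).ringCon.mk' x = 0 ↔ x ∈ monomialIdeal k R := by
  rw [← map_zero (monomialIdeal k R).ringCon.mk']
  exact (RingCon.eq _).trans (TwoSidedIdeal.mem_iff _ _).symm

lemma mk_smul (c : k) (x : FreeAlgebra k (Fin s)) :
    (monomialIdeal k R).ringCon.mk' (c • x) = c • (monomialIdeal k R).ringCon.mk' x := rfl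

theorem isMonomialBasis : IsMonomialBasis k (word k R) (zeroWords k R) := by
  refine ⟨fun w hw => (mk_eq_zero_iff k R _).2 hw, ?_, ?_⟩
  · rw [linearIndependent_iff']
    intro t c hc i hi
    have h1 : ∑ j ∈ t, c j • monomial k (j : FreeMonoid (Fin s)) ∈ monomialIdeal k R := by
      rw [← mk_eq_zero_iff, map_sum, ← hc]
      rfl
    have hi' : (i : FreeMonoid (Fin s)) ∉ factorWords R := by
      rw [← zeroWords_eq k]; exact i.2
    have h2 := repr_eq_zero_of_mem k R h1 hi'
    simp_rw [← basisFreeMonoid_apply, map_sum, map_smul, Module.Basis.repr_self] at h2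
    simp only [Finsupp.finsetSum_apply, Finsupp.smul_apply] at h2
    rw [Finset.sum_eq_single i] at h2
    · simpa using h2
    · intro j _ hj
      rw [Finsupp.single_eq_of_ne (fun h => hj (Subtype.ext h.symm)), smul_zero]
    · exact fun h => absurd hi h
  · rintro x -
    obtain ⟨y, rfl⟩ := (monomialIdeal k R).ringCon.mk'_surjective x
    have hy : y ∈ Submodule.span k (Set.range (monomial k)) := by
      rw [← funext (basisFreeMonoid_apply k), Module.Basis.span_eq]; trivial
    induction hy using Submodule.span_induction with
    | mem y hy =>
      obtain ⟨w, rfl⟩ := hy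
      by_cases hw : w ∈ zeroWords k R
      · rw [(mk_eq_zero_iff k R _).2 hw]; exact Submodule.zero_mem _
      · exact Submodule.subset_span ⟨⟨w, hw⟩, rfl⟩
    | zero => rw [map_zero]; exact Submodule.zero_mem _
    | add y z _ _ hy hz => rw [map_add]; exact Submodule.add_mem _ hy hz
    | smul c y _ hy => rw [mk_smul]; exact Submodule.smul_mem _ _ hy

end MonomialBasis

/-! ### Chains and walks in the CPS graph -/

section Walks

/-- The number of walks of length `n` starting at `v`. -/
def walkCount {V : Type*} [Fintype V] (Γ : Digraph V) : ℕ → V → ℕ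
  | 0, _ => 1
  | n + 1, v => by classical exact ∑ w with Γ.Adj v w, walkCount Γ n w

variable (k : Type u) [Field k] {s : ℕ} (R : Finset (FreeMonoid (Fin s)))

/-- The vertices of the CPS graph. -/
abbrev Vertex : Type := {w : FreeMonoid (Fin s) // IsVertex k R w}

/-- A letter as a vertex. -/
def letter (a : Fin s) : Vertex k R := ⟨FreeMonoid.of a, IsVertex.letter a⟩

-- A relation occurring in `w * m` must begin at the start of `w` by minimality, unless it lies
-- inside `m`, which forces `w = 1`. It cannot end within `w`, as `w ∉ I`; so `w` is a prefix of it.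
-- This gives finiteness of the graph.
variable {R} in
lemma exists_prefix_of_mem_annihilatorWords {m w : FreeMonoid (Fin s)}
    (hw : w ∈ annihilatorWords k R m) : w = 1 ∨ ∃ r ∈ R, w.toList <+: r.toList := by
  have hF := zeroWords_eq k R
  obtain ⟨h1, h2, h3⟩ := hw
  change w ∉ zeroWords k R at h1
  change w * m ∈ zeroWords k R at h2
  change ∀ u v, w = u * v → v * m ∈ zeroWords k R → u = 1 at h3
  rw [hF] at h1 h2 h3
  by_cases hm : m ∈ factorWords R
  · exact Or.inl (h3 w 1 (mul_one w).symm (by simpa using hm))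
  right
  obtain ⟨r, hr, x, y, hxy⟩ := h2
  have hx : x = 1 := by
    have hl : w.toList ++ m.toList = x.toList ++ (r * y).toList := by
      rw [mul_assoc] at hxy
      exact congrArg FreeMonoid.toList hxy
    rcases List.append_eq_append_iff.1 hl with ⟨c, h4, h5⟩ | ⟨c, h4, h5⟩
    · exact absurd ⟨r, hr, FreeMonoid.ofList c, y, by rw [mul_assoc]; exact h5⟩ hm
    · exact h3 x (FreeMonoid.ofList c) h4 ⟨r, hr, 1, y, by rw [one_mul]; exact h5.symm⟩
  subst hx
  have hl : w.toList ++ m.toList = r.toList ++ y.toList := by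
    rw [one_mul] at hxy
    exact congrArg FreeMonoid.toList hxy
  rcases List.append_eq_append_iff.1 hl with ⟨c, h4, _⟩ | ⟨c, h4, _⟩
  · exact ⟨r, hr, c, h4.symm⟩
  · exact absurd ⟨r, hr, 1, FreeMonoid.ofList c, by rw [one_mul]; exact h4⟩ h1

theorem finite_vertex : Finite (Vertex k R) := by
  refine Set.Finite.subset (s := Set.range (FreeMonoid.of (α := Fin s)) ∪ ({1} ∪
    ⋃ r ∈ R, FreeMonoid.ofList '' {l | l ∈ r.toList.inits})) ?_ ?_
  · refine (Set.finite_range _).union ((Set.finite_singleton _).union ?_)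
    exact R.finite_toSet.biUnion fun r _ => (List.finite_toSet _).image _
  · intro w hw
    cases hw with
    | letter a => exact Or.inl ⟨a, rfl⟩
    | step _ hw =>
      rcases exists_prefix_of_mem_annihilatorWords k hw with h | ⟨r, hr, h⟩
      · exact Or.inr (Or.inl h)
      · refine Or.inr (Or.inr (Set.mem_biUnion hr ⟨w.toList, ?_, rfl⟩))
        simpa using h

/-- Chains of words starting at a vertex are walks. -/
lemma finite_chain_and_card [Fintype (Vertex k R)] (n : ℕ) (v : Vertex k R) :
    Finite (Chain (zeroWords k R) n (residual (zeroWords k R) v)) ∧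
    Nat.card (Chain (zeroWords k R) n (residual (zeroWords k R) v)) =
      walkCount (cpsGraph k R) n v := by
  classical
  induction n generalizing v with
  | zero => exact ⟨inferInstanceAs (Finite Unit), Nat.card_unique (α := Unit)⟩
  | succ n ih =>
    let e : Chain (zeroWords k R) (n + 1) (residual (zeroWords k R) v) ≃
        Σ w : {w : Vertex k R // (cpsGraph k R).Adj v w},
          Chain (zeroWords k R) n (residual (zeroWords k R) w.1) :=
      -- The minimal words of `residual (zeroWords k R) v` are `annihilatorWords k R v` by
      -- definition, that is, the successors of `v`.
      Equiv.sigmaCongr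
        { toFun := fun a => ⟨⟨a.1, IsVertex.step v.2 a.2⟩, a.2⟩
          invFun := fun w => ⟨w.1.1, w.2⟩
          left_inv := fun _ => rfl
          right_inv := fun _ => rfl }
        fun _ => Equiv.refl _
    have hfin := fun w => (ih w).1
    refine ⟨Finite.of_equiv _ e.symm, ?_⟩
    rw [Nat.card_congr e, Nat.card_sigma, walkCount]
    simp_rw [(ih _).2]
    exact (Finset.sum_subtype _ (by simp) (fun w => walkCount (cpsGraph k R) n w)).symm

variable {R} in
lemma one_notMem_zeroWords (hR : DegreesAtLeastTwo R) : (1 : FreeMonoid (Fin s)) ∉ zeroWords k R := by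
  rw [zeroWords_eq]
  rintro ⟨r, hr, u, v, h⟩
  have h1 := hR r hr
  have h2 := congrArg FreeMonoid.length h
  simp only [FreeMonoid.length_mul, FreeMonoid.length_one] at h2
  omega

-- Degree at least `2` keeps the letters outside the ideal, so that the first step of every
-- resolution is indexed by `𝔊_0`.
variable {R} in
lemma minimalWords_nonempty_eq (hR : DegreesAtLeastTwo R) :
    minimalWords (zeroWords k R) {w | w ≠ 1} = Set.range FreeMonoid.of := by
  ext w
  constructor
  · rintro ⟨-, h2, h3⟩
    induction w using FreeMonoid.casesOn with
    | one => exact absurd rfl h2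
    | of_mul a w =>
      by_cases hw : w = 1
      · exact ⟨a, by simp [hw]⟩
      · exact absurd (h3 (FreeMonoid.of a) w rfl hw) (FreeMonoid.of_ne_one a)
  · rintro ⟨a, rfl⟩
    refine ⟨?_, FreeMonoid.of_ne_one a, fun u v h hv => ?_⟩
    · rw [zeroWords_eq]
      rintro ⟨r, hr, u, v, h⟩
      have h1 := hR r hr
      have h2 := congrArg FreeMonoid.length h
      simp only [FreeMonoid.length_mul, FreeMonoid.length_of] at h2
      omega
    · have h2 := congrArg FreeMonoid.length h
      have h4 : v.length ≠ 0 := fun h => hv (FreeMonoid.length_eq_zero.1 h)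
      simp only [FreeMonoid.length_mul, FreeMonoid.length_of] at h2
      exact FreeMonoid.length_eq_zero.1 (by omega)

variable {R} in
/-- Chains starting from the root are walks starting at letters. -/
def rootChainEquiv (hR : DegreesAtLeastTwo R) (n : ℕ) :
    Chain (zeroWords k R) (n + 1) {w | w ≠ 1} ≃
      Σ a : Fin s, Chain (zeroWords k R) n (residual (zeroWords k R) (FreeMonoid.of a)) :=
  (Equiv.sigmaCongr
    ((Equiv.ofInjective _ FreeMonoid.of_injective).trans
      (Equiv.setCongr (minimalWords_nonempty_eq k hR).symm))
    fun _ => Equiv.refl _).symm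

variable {R} in
lemma finite_rootChain_and_card [Fintype (Vertex k R)] (hR : DegreesAtLeastTwo R) (n : ℕ) :
    Finite (Chain (zeroWords k R) (n + 1) {w | w ≠ 1}) ∧
    Nat.card (Chain (zeroWords k R) (n + 1) {w | w ≠ 1}) =
      ∑ a, walkCount (cpsGraph k R) n (letter k R a) := by
  have hfin := fun a => (finite_chain_and_card k R n (letter k R a)).1
  change ∀ a, Finite (Chain (zeroWords k R) n (residual (zeroWords k R) (FreeMonoid.of a))) at hfin
  refine ⟨Finite.of_equiv _ (rootChainEquiv k hR n).symm, ?_⟩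
  rw [Nat.card_congr (rootChainEquiv k hR n), Nat.card_sigma]
  exact Finset.sum_congr rfl fun a _ => (finite_chain_and_card k R n (letter k R a)).2

/-! ### The trivial module and its `Ext` groups. -/

section Trivial

open scoped ModuleCat

variable {R} (hR : DegreesAtLeastTwo R)

lemma word_smul_trivialModule (w : FreeMonoid (Fin s)) (hw : w ≠ 1) (x : trivialModule k hR) :
    word k R w • x = 0 := by
  let y : k := x
  change augmentation k hR (word k R w) * y = 0
  have : augmentation k hR (word k R w) = freeAugmentation k (monomial k w) := rfl
  rw [this, freeAugmentation_monomial hw, zero_mul]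

/-- The trivial module is one-dimensional. -/
def trivialModuleEquiv : trivialModule k hR ≃ₗ[k] k where
  toFun x := x
  invFun x := x
  left_inv _ := rfl
  right_inv _ := rfl
  map_add' _ _ := rfl
  map_smul' c x := by
    let y : k := x
    change augmentation k hR (algebraMap k (MonomialAlgebra k R) c) * y = c * y
    rw [AlgHom.commutes]
    rfl

theorem finite_ext_and_finrank (n : ℕ) [Fintype (Vertex k R)] :
    Module.Finite k (E k hR n) ∧
      Module.finrank k (E k hR n) = Nat.card (Chain (zeroWords k R) n {w | w ≠ 1}) := by
  let b : Module.Basis PUnit.{u + 1} k (trivialModule k hR) :=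
    (Module.Basis.singleton PUnit k).map (trivialModuleEquiv k hR).symm
  have hφ := isMonomialBasis k R
  have hpres := isPresentation_basis (φ := word k R) (one_notMem_zeroWords k hR)
    (fun u v h => by
      have := congrArg FreeMonoid.length h
      rw [FreeMonoid.length_mul, FreeMonoid.length_one] at this
      exact FreeMonoid.length_eq_zero.1 (by omega)) b
  let e : ∀ n, (Σ _ : PUnit.{u + 1}, Chain (zeroWords k R) n {w | w ≠ 1}) ≃
      Chain (zeroWords k R) n {w | w ≠ 1} := fun n =>
    ⟨fun p => p.2, fun c => ⟨⟨⟩, c⟩, fun _ => rfl, fun _ => rfl⟩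
  have h := finrank_ext_eq_card hφ (trivialModule k hR) (word_smul_trivialModule k hR)
    ((trivialModuleEquiv k hR).finrank_eq.trans (Module.finrank_self k)) n hpres
    (fun j w hw => word_smul_trivialModule k hR w hw _) (fun _ h => h rfl) (fun n => by
      have : Finite (Chain (zeroWords k R) n {w | w ≠ 1}) := by
        cases n with
        | zero => exact inferInstanceAs (Finite Unit)
        | succ n => exact (finite_rootChain_and_card k hR n).1
      exact Finite.of_equiv _ (e n).symm)
  rw [Nat.card_congr (e n)] at h
  exact h

end Trivial

end Walks

/-! ### Circuits in a digraph -/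

section Circuits

variable {V : Type*} {Γ : Digraph V}

/-- Reachability by a walk. -/
abbrev Reach (Γ : Digraph V) : V → V → Prop := Relation.ReflTransGen Γ.Adj

lemma reach_of_isChain {y v : V} {t : List V} (h : (y :: (t ++ [v])).IsChain Γ.Adj) :
    Reach Γ y v := by
  induction t generalizing y with
  | nil => exact .single (by simpa using h)
  | cons a t ih =>
    rw [List.cons_append, List.isChain_cons_cons] at h
    exact .head h.1 (ih h.2)

lemma exists_path_of_reach {w u : V} (h : Reach Γ w u) :
    ∃ q : List V, q.IsChain Γ.Adj ∧ q.Nodup ∧ q.head? = some w ∧ q.getLast? = some u := by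
  induction h using Relation.ReflTransGen.head_induction_on with
  | refl => exact ⟨[u], by simp, by simp, rfl, rfl⟩
  | @head a b hab _ ih =>
    obtain ⟨q, h1, h2, h3, h4⟩ := ih
    by_cases ha : a ∈ q
    · obtain ⟨l, t, rfl⟩ := List.append_of_mem ha
      refine ⟨a :: t, h1.right_of_append, h2.of_append_right, rfl, ?_⟩
      rw [List.getLast?_append_of_ne_nil _ (by simp)] at h4
      exact h4
    · refine ⟨a :: q, ?_, by simp [ha, h2], rfl, ?_⟩
      · rw [List.isChain_cons]
        exact ⟨fun y hy => by rw [h3] at hy; cases hy; exact hab, h1⟩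
      · rw [List.getLast?_cons, h4]; rfl

lemma isCircuit_cons_iff {v : V} {l : List V} :
    IsCircuit Γ (v :: l : List V) ↔ (v :: l).Nodup ∧ (v :: (l ++ [v])).IsChain Γ.Adj := by
  rw [IsCircuit, Cycle.nodup_coe_iff, Cycle.chain_coe_cons]
  simp

lemma exists_eq_cons_of_mem {c : Cycle V} {v : V} (hv : v ∈ c) :
    ∃ l : List V, c = ((v :: l : List V) : Cycle V) := by
  induction c using Quot.inductionOn with
  | _ L =>
    obtain ⟨s, t, rfl⟩ := List.append_of_mem (Cycle.mem_coe_iff.1 hv)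
    exact ⟨t ++ s, Cycle.coe_eq_coe.2 (by simpa using List.isRotated_append (l := s) (l' := v :: t))⟩

/-- As `v` occurs only once, only the trivial rotation keeps it in front. -/
lemma cons_eq_of_isRotated {v : V} {l l' : List V} (hl : (v :: l).Nodup)
    (h : (v :: l) ~r (v :: l')) : l = l' := by
  obtain ⟨n, hn, h⟩ := List.isRotated_iff_mod.1 h
  rcases n with _ | n
  · simpa using h
  · rw [List.rotate_eq_drop_append_take hn, List.drop_succ_cons] at h
    rcases hd : l.drop n with _ | ⟨x, t⟩
    · rw [hd, List.nil_append, List.take_of_length_le] at h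
      · simpa using h
      · have := List.drop_eq_nil_iff.1 hd
        simpa using this
    · rw [hd, List.cons_append] at h
      have hx : x = v := (List.cons.inj h).1
      have : x ∈ l := List.mem_of_mem_drop (by rw [hd]; simp : x ∈ l.drop n)
      exact absurd (hx ▸ this) (List.nodup_cons.1 hl).1

/-- An edge to a vertex from which one can return lies on a circuit. -/
lemma exists_circuit_of_adj_of_reach {u w : V} (h : Γ.Adj u w) (hw : Reach Γ w u) :
    ∃ l : List V, IsCircuit Γ (u :: l : List V) ∧ (l ++ [u]).head? = some w := by
  obtain ⟨q, h1, h2, h3, h4⟩ := exists_path_of_reach hw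
  obtain ⟨l, rfl⟩ := List.getLast?_eq_some_iff.1 h4
  refine ⟨l, isCircuit_cons_iff.2 ⟨?_, ?_⟩, h3⟩
  · rw [List.nodup_append_comm] at h2
    exact h2
  · rw [List.isChain_cons]
    exact ⟨fun y hy => by rw [h3] at hy; cases hy; exact h, h1⟩

lemma exists_successor_of_isCircuit {v : V} {c : Cycle V} (hc : IsCircuit Γ c) (hv : v ∈ c) :
    ∃ w ∈ c, Γ.Adj v w ∧ Reach Γ w v := by
  obtain ⟨l, rfl⟩ := exists_eq_cons_of_mem hv
  have h := (isCircuit_cons_iff.1 hc).2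
  cases l with
  | nil => exact ⟨v, by simp, by simpa using h, .refl⟩
  | cons a l =>
    rw [List.cons_append, List.isChain_cons_cons] at h
    exact ⟨a, by simp, h.1, reach_of_isChain h.2⟩

lemma reach_of_mem_circuit {v w : V} {c : Cycle V} (hc : IsCircuit Γ c) (hv : v ∈ c) (hw : w ∈ c) :
    Reach Γ v w := by
  obtain ⟨l, rfl⟩ := exists_eq_cons_of_mem hv
  have h := (isCircuit_cons_iff.1 hc).2
  rw [Cycle.mem_coe_iff, List.mem_cons] at hw
  rcases hw with rfl | hw
  · exact .refl
  · obtain ⟨s, t, rfl⟩ := List.append_of_mem hw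
    refine reach_of_isChain (t := s) (h.prefix ⟨t ++ [v], ?_⟩)
    simp

/-- Each of the two edges closes up to a circuit through `u`; these circuits coincide, and a circuit
determines the successor of `u`. -/
lemma successor_unique (hM : ¬ HasMeetingCircuits Γ) {u w w' : V} (h : Γ.Adj u w)
    (hw : Reach Γ w u) (h' : Γ.Adj u w') (hw' : Reach Γ w' u) : w = w' := by
  obtain ⟨l, hl, hlw⟩ := exists_circuit_of_adj_of_reach h hw
  obtain ⟨l', hl', hlw'⟩ := exists_circuit_of_adj_of_reach h' hw'
  by_cases he : ((u :: l : List V) : Cycle V) = (u :: l' : List V)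
  · have := cons_eq_of_isRotated (isCircuit_cons_iff.1 hl).1 (Cycle.coe_eq_coe.1 he)
    subst this
    rw [hlw] at hlw'
    exact Option.some.inj hlw'
  · exact absurd ⟨_, _, hl, hl', he, u, by simp, by simp⟩ hM

/-- The two ways back to `v` are followed to their first difference. Since `v` occurs in neither
interior, a way that ends differs from one that goes on, and both successors lead back through `v`
to the branching vertex. -/
lemma exists_branching_of_ne {v : V} (l l' : List V) (x : V)
    (h : (x :: (l ++ [v])).IsChain Γ.Adj) (h' : (x :: (l' ++ [v])).IsChain Γ.Adj)
    (hl : v ∉ l) (hl' : v ∉ l') (hne : l ≠ l') (hx : Reach Γ v x) :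
    ∃ u w w', Γ.Adj u w ∧ Γ.Adj u w' ∧ w ≠ w' ∧ Reach Γ w u ∧ Reach Γ w' u := by
  induction l generalizing x l' with
  | nil =>
    cases l' with
    | nil => exact absurd rfl hne
    | cons b l' =>
      rw [List.cons_append, List.isChain_cons_cons] at h'
      refine ⟨x, v, b, by simpa using h, h'.1, ?_, hx, (reach_of_isChain h'.2).trans hx⟩
      rintro rfl
      simp at hl'
  | cons a l ih =>
    rw [List.cons_append, List.isChain_cons_cons] at h
    cases l' with
    | nil =>
      refine ⟨x, v, a, by simpa using h', h.1, ?_, hx, (reach_of_isChain h.2).trans hx⟩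
      rintro rfl
      simp at hl
    | cons b l' =>
      rw [List.cons_append, List.isChain_cons_cons] at h'
      by_cases hab : a = b
      · subst hab
        exact ih l' a h.2 h'.2 (fun hm => hl (List.mem_cons_of_mem _ hm))
          (fun hm => hl' (List.mem_cons_of_mem _ hm)) (fun he => hne (by rw [he])) (hx.tail h.1)
      · exact ⟨x, a, b, h.1, h'.1, hab, (reach_of_isChain h.2).trans hx,
          (reach_of_isChain h'.2).trans hx⟩

lemma exists_branching (hM : HasMeetingCircuits Γ) :
    ∃ u w w', Γ.Adj u w ∧ Γ.Adj u w' ∧ w ≠ w' ∧ Reach Γ w u ∧ Reach Γ w' u := by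
  obtain ⟨c, c', hc, hc', hne, v, hv, hv'⟩ := hM
  obtain ⟨l, rfl⟩ := exists_eq_cons_of_mem hv
  obtain ⟨l', rfl⟩ := exists_eq_cons_of_mem hv'
  rw [isCircuit_cons_iff] at hc hc'
  exact exists_branching_of_ne l l' v hc.2 hc'.2 (List.nodup_cons.1 hc.1).1
    (List.nodup_cons.1 hc'.1).1 (fun h => hne (by rw [h])) .refl

lemma circuit_unique (hM : ¬ HasMeetingCircuits Γ) {c c' : Cycle V} (hc : IsCircuit Γ c)
    (hc' : IsCircuit Γ c') {v : V} (hv : v ∈ c) (hv' : v ∈ c') : c = c' := by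
  by_contra h
  exact hM ⟨c, c', hc, hc', h, v, hv, hv'⟩

end Circuits

/-! ### Circuits contained in walks -/

section CircuitsIn

variable {V : Type*} (Γ : Digraph V)

/-- The circuits contained in a walk. -/
def circuitsIn (p : List V) : Set (Cycle V) := {c | IsCircuit Γ c ∧ ContainsCircuit p c}

lemma circuitsIn_mono {p q : List V} (h : p <:+: q) : circuitsIn Γ p ⊆ circuitsIn Γ q :=
  fun _ ⟨hc, a, l, hl, hp⟩ => ⟨hc, a, l, hl, hp.trans h⟩

lemma circuitsIn_singleton (v : V) : circuitsIn Γ [v] = ∅ := by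
  refine Set.eq_empty_of_forall_notMem fun c hc => ?_
  obtain ⟨_, a, l, _, hp⟩ := hc
  have := hp.length_le
  simp at this

lemma finite_circuits [Finite V] (C : Set (Cycle V)) (hC : ∀ c ∈ C, IsCircuit Γ c) : C.Finite := by
  classical
  have := Fintype.ofFinite V
  have h : Finite {c : Cycle V // c.Nodup} := inferInstance
  exact Set.Finite.subset (s := {c : Cycle V | c.Nodup}) h fun c hc => (hC c hc).2.1

lemma finite_circuitsIn [Finite V] (p : List V) : (circuitsIn Γ p).Finite :=
  finite_circuits Γ _ fun _ hc => hc.1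

variable {Γ}

lemma mem_of_mem_circuitsIn {p : List V} {c : Cycle V} (hc : c ∈ circuitsIn Γ p) {v : V}
    (hv : v ∈ c) : v ∈ p := by
  obtain ⟨_, a, l, rfl, hp⟩ := hc
  exact hp.subset (List.mem_append_left _ (Cycle.mem_coe_iff.1 hv))

/-- A circuit contained in a walk, but not in its tail, is the beginning of the walk. -/
lemma mem_circuitsIn_cons {v : V} {p : List V} {c : Cycle V} (hc : c ∈ circuitsIn Γ (v :: p)) :
    c ∈ circuitsIn Γ p ∨ ∃ l, c = ((v :: l : List V) : Cycle V) ∧ (l ++ [v]) <+: p := by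
  obtain ⟨hc, a, l, rfl, hp⟩ := hc
  rcases List.infix_cons_iff.1 hp with h | h
  · right
    obtain ⟨rfl, h'⟩ := List.cons_prefix_cons.1 h
    exact ⟨l, rfl, h'⟩
  · exact Or.inl ⟨hc, a, l, rfl, h⟩

lemma isWalk_cons_cons {v w : V} {p : List V} :
    IsWalk Γ (v :: w :: p) ↔ Γ.Adj v w ∧ IsWalk Γ (w :: p) := by
  simp [IsWalk, List.isChain_cons_cons]

lemma reach_of_isWalk {v x : V} {p : List V} (h : IsWalk Γ (v :: p)) (hx : x ∈ v :: p) :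
    Reach Γ v x := by
  rcases List.mem_cons.1 hx with rfl | hx
  · exact .refl
  · obtain ⟨s, t, rfl⟩ := List.append_of_mem hx
    exact reach_of_isChain (t := s) (h.2.prefix ⟨t, by simp⟩)

end CircuitsIn

/-! ### Growth of the number of walks -/

section WalkGrowth

variable {V : Type*} [Fintype V] {Γ : Digraph V}

/-- The number of walks of length at most `n` starting at `v`. -/
def walksUpTo (Γ : Digraph V) (n : ℕ) (v : V) : ℕ := ∑ i ∈ Finset.range (n + 1), walkCount Γ i v

open scoped Classical in
lemma walkCount_succ (n : ℕ) (v : V) :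
    walkCount Γ (n + 1) v = ∑ w with Γ.Adj v w, walkCount Γ n w := by
  rw [walkCount]

lemma walksUpTo_zero (v : V) : walksUpTo Γ 0 v = 1 := by simp [walksUpTo, walkCount]

open scoped Classical in
lemma walksUpTo_succ (n : ℕ) (v : V) :
    walksUpTo Γ (n + 1) v = 1 + ∑ w with Γ.Adj v w, walksUpTo Γ n w := by
  rw [walksUpTo, Finset.sum_range_succ', add_comm]
  congr 1
  simp_rw [walksUpTo, walkCount_succ]
  exact Finset.sum_comm

lemma walksUpTo_mono (v : V) {m n : ℕ} (h : m ≤ n) : walksUpTo Γ m v ≤ walksUpTo Γ n v :=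
  Finset.sum_le_sum_of_subset (Finset.range_subset_range.2 (by omega))

lemma one_le_walksUpTo (n : ℕ) (v : V) : 1 ≤ walksUpTo Γ n v :=
  (walksUpTo_zero v).ge.trans (walksUpTo_mono v n.zero_le)

lemma walksUpTo_le_of_adj {v w : V} (h : Γ.Adj v w) (n : ℕ) :
    walksUpTo Γ n w ≤ walksUpTo Γ (n + 1) v := by
  classical
  rw [walksUpTo_succ]
  exact (Finset.single_le_sum (f := fun w => walksUpTo Γ n w) (fun _ _ => Nat.zero_le _)
    (Finset.mem_filter.2 ⟨Finset.mem_univ w, h⟩)).trans (Nat.le_add_left _ _)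

lemma exists_walksUpTo_le_of_reach {v w : V} (h : Reach Γ v w) :
    ∃ a, ∀ n, walksUpTo Γ n w ≤ walksUpTo Γ (n + a) v := by
  induction h using Relation.ReflTransGen.head_induction_on with
  | refl => exact ⟨0, fun _ => le_rfl⟩
  | head h _ ih =>
    obtain ⟨a, ha⟩ := ih
    exact ⟨a + 1, fun n => (ha n).trans (walksUpTo_le_of_adj h _)⟩

/-- The number of walks starting at `v` grows at least as `n ^ d`. -/
def GrowsAtLeast (Γ : Digraph V) (v : V) (d : ℕ) : Prop := ∃ K, ∀ n, n ^ d ≤ K * walksUpTo Γ n v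

lemma growsAtLeast_zero (v : V) : GrowsAtLeast Γ v 0 :=
  ⟨1, fun n => by simpa using one_le_walksUpTo n v⟩

lemma GrowsAtLeast.mono {v : V} {d e : ℕ} (h : GrowsAtLeast Γ v e) (hde : d ≤ e) :
    GrowsAtLeast Γ v d := by
  obtain ⟨K, hK⟩ := h
  refine ⟨K + 1, fun n => ?_⟩
  have h1 : n ^ d ≤ n ^ e + 1 := by
    rcases n.eq_zero_or_pos with rfl | hn
    · exact (show 0 ^ d ≤ 1 by cases d <;> simp).trans (Nat.le_add_left _ _)
    · exact (Nat.pow_le_pow_right hn hde).trans (by omega)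
  have := one_le_walksUpTo (Γ := Γ) n v
  nlinarith [hK n]

lemma GrowsAtLeast.of_adj {v w : V} {d : ℕ} (h : GrowsAtLeast Γ w d) (hvw : Γ.Adj v w) :
    GrowsAtLeast Γ v d := by
  obtain ⟨K, hK⟩ := h
  refine ⟨2 ^ d * (K + 1), fun n => ?_⟩
  cases n with
  | zero =>
    have h0 : 0 ^ d ≤ 1 := by cases d <;> simp
    have h1 : 1 ≤ 2 ^ d * (K + 1) := Nat.succ_le_of_lt (by positivity)
    rw [walksUpTo_zero]
    omega
  | succ n =>
    have h1 : (n + 1) ^ d ≤ 2 ^ d * (n ^ d + 1) := by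
      rcases n.eq_zero_or_pos with rfl | hn
      · rw [zero_add, one_pow]
        exact Nat.succ_le_of_lt (by positivity)
      · calc (n + 1) ^ d ≤ (2 * n) ^ d := Nat.pow_le_pow_left (by omega) d
          _ = 2 ^ d * n ^ d := mul_pow _ _ _
          _ ≤ _ := Nat.mul_le_mul_left _ (by omega)
    refine h1.trans ?_
    rw [mul_assoc]
    refine Nat.mul_le_mul_left _ ?_
    have h2 := walksUpTo_le_of_adj hvw n
    have h3 := one_le_walksUpTo (Γ := Γ) n w
    nlinarith [hK n]

lemma GrowsAtLeast.of_reach {v w : V} {d : ℕ} (h : GrowsAtLeast Γ w d) (hvw : Reach Γ v w) :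
    GrowsAtLeast Γ v d := by
  induction hvw using Relation.ReflTransGen.head_induction_on with
  | refl => exact h
  | head hab _ ih => exact ih.of_adj hab

/-- If one can return to `u` after leaving along one edge, then any other edge contributes one more
degree of growth. -/
lemma GrowsAtLeast.of_circuit {u v w : V} {d : ℕ} (hw : GrowsAtLeast Γ w d) (huv : Γ.Adj u v)
    (hvu : Reach Γ v u) (huw : Γ.Adj u w) (hne : v ≠ w) : GrowsAtLeast Γ u (d + 1) := by
  classical
  obtain ⟨K, hK⟩ := hw
  obtain ⟨a, ha⟩ := exists_walksUpTo_le_of_reach hvu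
  obtain ⟨l, hl⟩ : ∃ l, l = a + 1 := ⟨_, rfl⟩
  -- `l` is the cost of one return to `u`: a walk may either go once round, or leave through `w`.
  have h1 : ∀ m, walksUpTo Γ m u + walksUpTo Γ m w ≤ walksUpTo Γ (m + l) u := by
    intro m
    rw [hl, ← add_assoc, walksUpTo_succ]
    have h2 : ∑ x ∈ {v, w}, walksUpTo Γ (m + a) x ≤
        ∑ x with Γ.Adj u x, walksUpTo Γ (m + a) x := by
      refine Finset.sum_le_sum_of_subset fun x hx => ?_
      rw [Finset.mem_insert, Finset.mem_singleton] at hx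
      rcases hx with rfl | rfl <;> simp [huv, huw]
    rw [Finset.sum_pair hne] at h2
    have h3 := ha m
    have h4 := walksUpTo_mono (Γ := Γ) w (Nat.le_add_right m a)
    omega
  -- The walk may leave through `w` after any of `j` rounds.
  have h2 : ∀ j m, j * walksUpTo Γ m w ≤ walksUpTo Γ (m + j * l) u := by
    intro j m
    induction j with
    | zero => simp
    | succ j ih =>
      have h3 := h1 (m + j * l)
      have h4 := walksUpTo_mono (Γ := Γ) w (Nat.le_add_right m (j * l))
      rw [add_mul, one_mul, add_mul, one_mul, ← add_assoc]
      omega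
  have hl1 : 1 ≤ l := by omega
  refine ⟨(4 * l) ^ (d + 1) * (K + 1), fun n => ?_⟩
  -- Half of the length is spent on the rounds and half after leaving: `j * l` steps each, so `n` is
  -- comparable with `2 * j * l`.
  obtain ⟨j, hj⟩ : ∃ j, j = n / (2 * l) := ⟨_, rfl⟩
  have hn1 : 2 * l * j ≤ n := by rw [hj]; exact Nat.mul_div_le _ _
  have hn2 : n < 2 * l * (j + 1) := by
    rw [hj]; exact Nat.lt_mul_div_succ _ (by omega)
  rcases j.eq_zero_or_pos with h0 | hj0
  · have h3 : n ^ (d + 1) ≤ (4 * l) ^ (d + 1) := Nat.pow_le_pow_left (by rw [h0] at hn2; omega) _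
    have h4 := one_le_walksUpTo (Γ := Γ) n u
    calc n ^ (d + 1) ≤ (4 * l) ^ (d + 1) * 1 * 1 := by simpa using h3
      _ ≤ _ := Nat.mul_le_mul (Nat.mul_le_mul_left _ (by omega)) h4
  · have h3 : n ≤ 4 * l * j := by nlinarith
    have h4 : j * walksUpTo Γ (j * l) w ≤ walksUpTo Γ n u :=
      (h2 j (j * l)).trans (walksUpTo_mono u (by linarith))
    have h5 : j ^ d ≤ K * walksUpTo Γ (j * l) w :=
      (Nat.pow_le_pow_left (by nlinarith) d).trans (hK (j * l))
    calc n ^ (d + 1) ≤ (4 * l * j) ^ (d + 1) := Nat.pow_le_pow_left h3 _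
      _ = (4 * l) ^ (d + 1) * (j ^ d * j) := by rw [mul_pow, pow_succ j]
      _ ≤ (4 * l) ^ (d + 1) * ((K * walksUpTo Γ (j * l) w) * j) := by gcongr
      _ = (4 * l) ^ (d + 1) * K * (j * walksUpTo Γ (j * l) w) := by ring
      _ ≤ (4 * l) ^ (d + 1) * (K + 1) * walksUpTo Γ n u := by
        gcongr
        omega

lemma one_le_walkCount_of_returning (i : ℕ) {v w : V} (h : Γ.Adj v w) (hw : Reach Γ w v) :
    1 ≤ walkCount Γ i v := by
  classical
  induction i generalizing v w with
  | zero => exact le_rfl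
  | succ i ih =>
    rw [walkCount_succ]
    have h1 : 1 ≤ walkCount Γ i w := by
      rcases Relation.ReflTransGen.cases_head hw with rfl | ⟨x, hx, hxv⟩
      · exact ih h hw
      · exact ih hx (hxv.tail h)
    exact h1.trans (Finset.single_le_sum (f := fun w => walkCount Γ i w)
      (fun _ _ => Nat.zero_le _) (Finset.mem_filter.2 ⟨Finset.mem_univ w, h⟩))

lemma growsAtLeast_one_of_returning {v w : V} (h : Γ.Adj v w) (hw : Reach Γ w v) :
    GrowsAtLeast Γ v 1 := by
  refine ⟨1, fun n => ?_⟩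
  rw [pow_one, one_mul]
  calc n ≤ ∑ _i ∈ Finset.range (n + 1), 1 := by simp
    _ ≤ _ := Finset.sum_le_sum fun i _ => one_le_walkCount_of_returning i h hw

/-- Meeting circuits force superpolynomial growth. -/
lemma exists_growsAtLeast_of_meeting (hM : HasMeetingCircuits Γ) :
    ∃ u, ∀ d, GrowsAtLeast Γ u d := by
  obtain ⟨u, w, w', h, h', hne, hw, hw'⟩ := exists_branching hM
  refine ⟨u, fun d => ?_⟩
  induction d with
  | zero => exact growsAtLeast_zero u
  -- The second edge also leads back to `u`, so the growth already obtained at `u` is available at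
  -- `w'` and gains one more degree.
  | succ d ih => exact (ih.of_reach hw').of_circuit h hw h' hne

/-- A walk that runs inside a circuit which it does not contain leaves it, unless it contains no
circuit at all. -/
lemma exists_exit (hM : ¬ HasMeetingCircuits Γ) {c : Cycle V} (hc : IsCircuit Γ c) (p : List V)
    (ih : ∀ (w : V) (q : List V), q.length < p.length → IsWalk Γ (w :: q) →
      GrowsAtLeast Γ w (circuitsIn Γ (w :: q)).ncard)
    (x : V) (hx : x ∈ c) (hp : IsWalk Γ (x :: p)) (hcp : c ∉ circuitsIn Γ (x :: p)) :
    circuitsIn Γ (x :: p) = ∅ ∨ ∃ u ∈ c, ∃ w, Γ.Adj u w ∧ ¬ Reach Γ w u ∧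
      GrowsAtLeast Γ w (circuitsIn Γ (x :: p)).ncard := by
  induction p generalizing x with
  | nil => exact Or.inl (circuitsIn_singleton Γ x)
  | cons y p ihp =>
    obtain ⟨hxy, hp'⟩ := isWalk_cons_cons.1 hp
    have heq : circuitsIn Γ (x :: y :: p) = circuitsIn Γ (y :: p) := by
      refine Set.Subset.antisymm (fun c' hc' => ?_)
        (circuitsIn_mono Γ (List.suffix_cons _ _).isInfix)
      rcases mem_circuitsIn_cons hc' with h | ⟨l, rfl, -⟩
      · exact h
      · have := circuit_unique hM hc hc'.1 hx (by simp)
        exact absurd (this ▸ hc') hcp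
    by_cases hyx : Reach Γ y x
    · obtain ⟨z, hz, hxz, hzx⟩ := exists_successor_of_isCircuit hc hx
      have hy : y ∈ c := successor_unique hM hxy hyx hxz hzx ▸ hz
      rw [heq] at hcp ⊢
      exact ihp (fun w q hq hw => ih w q (hq.trans (Nat.lt_succ_self _)) hw) y hy hp' hcp
    · refine Or.inr ⟨x, hx, y, hxy, hyx, ?_⟩
      rw [heq]
      exact ih y p (Nat.lt_succ_self _) hp'

/-- Without meeting circuits, walks containing `d` circuits force growth of degree `d`. -/
theorem growsAtLeast_of_isWalk (hM : ¬ HasMeetingCircuits Γ) (v : V) (p : List V)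
    (hp : IsWalk Γ (v :: p)) : GrowsAtLeast Γ v (circuitsIn Γ (v :: p)).ncard := by
  induction hn : p.length using Nat.strong_induction_on generalizing v p with
  | _ n ih =>
    subst hn
    cases p with
    | nil => rw [circuitsIn_singleton, Set.ncard_empty]; exact growsAtLeast_zero v
    | cons w p =>
      obtain ⟨hvw, hp'⟩ := isWalk_cons_cons.1 hp
      -- Either the first vertex contributes no circuit, or the walk starts by going round a circuit
      -- `c` that its tail does not contain.
      by_cases hsub : circuitsIn Γ (v :: w :: p) ⊆ circuitsIn Γ (w :: p)
      · exact ((ih p.length (Nat.lt_succ_self _) w p hp' rfl).mono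
          (Set.ncard_le_ncard hsub (finite_circuitsIn Γ _))).of_adj hvw
      · obtain ⟨c, hc, hc'⟩ := Set.not_subset.1 hsub
        rcases mem_circuitsIn_cons hc with h | ⟨l, hl, hpre⟩
        · exact absurd h hc'
        have hv : v ∈ c := by rw [hl]; simp
        have hwv : Reach Γ w v := by
          refine reach_of_isWalk hp' (hpre.subset ?_)
          simp
        obtain ⟨z, hz, hvz, hzv⟩ := exists_successor_of_isCircuit hc.1 hv
        have hw : w ∈ c := successor_unique hM hvw hwv hvz hzv ▸ hz
        -- Only a circuit through `v` can be new, and there is just one.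
        have hins : circuitsIn Γ (v :: w :: p) ⊆ insert c (circuitsIn Γ (w :: p)) := by
          intro c' hc''
          rcases mem_circuitsIn_cons hc'' with h | ⟨l', rfl, -⟩
          · exact Or.inr h
          · exact Or.inl (circuit_unique hM hc''.1 hc.1 (by simp) hv)
        have hcard : (circuitsIn Γ (v :: w :: p)).ncard ≤ (circuitsIn Γ (w :: p)).ncard + 1 :=
          (Set.ncard_le_ncard hins ((finite_circuitsIn Γ _).insert c)).trans
            (Set.ncard_insert_le _ _)
        refine GrowsAtLeast.mono ?_ hcard
        rcases exists_exit hM hc.1 p (fun x q hq hx => ih q.length (hq.trans (Nat.lt_succ_self _))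
          x q hx rfl) w hw hp' hc' with h | ⟨u, hu, x, hux, hxu, hx⟩
        · rw [h, Set.ncard_empty]
          exact growsAtLeast_one_of_returning hvw hwv
        · obtain ⟨y, _, huy, hyu⟩ := exists_successor_of_isCircuit hc.1 hu
          exact (hx.of_circuit huy hyu hux (by rintro rfl; exact hxu hyu)).of_reach
            (reach_of_mem_circuit hc.1 hv hu)

/-- The largest number of circuits contained in a walk starting at `v`. -/
def circuitRank (Γ : Digraph V) (v : V) : ℕ :=
  sSup {n | ∃ p, IsWalk Γ (v :: p) ∧ n = (circuitsIn Γ (v :: p)).ncard}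

lemma bddAbove_circuitRank (v : V) :
    BddAbove {n | ∃ p, IsWalk Γ (v :: p) ∧ n = (circuitsIn Γ (v :: p)).ncard} := by
  refine ⟨{c | IsCircuit Γ c}.ncard, ?_⟩
  rintro _ ⟨p, _, rfl⟩
  exact Set.ncard_le_ncard (fun c hc => hc.1) (finite_circuits Γ _ fun _ h => h)

lemma ncard_le_circuitRank {v : V} {p : List V} (hp : IsWalk Γ (v :: p)) :
    (circuitsIn Γ (v :: p)).ncard ≤ circuitRank Γ v :=
  le_csSup (bddAbove_circuitRank v) ⟨p, hp, rfl⟩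

lemma exists_ncard_eq_circuitRank (v : V) :
    ∃ p, IsWalk Γ (v :: p) ∧ circuitRank Γ v = (circuitsIn Γ (v :: p)).ncard :=
  Nat.sSup_mem (s := {n | ∃ p, IsWalk Γ (v :: p) ∧ n = (circuitsIn Γ (v :: p)).ncard})
    ⟨_, [], by simp [IsWalk], rfl⟩ (bddAbove_circuitRank v)

lemma circuitRank_le_of_adj {v w : V} (h : Γ.Adj v w) : circuitRank Γ w ≤ circuitRank Γ v := by
  obtain ⟨p, hp, he⟩ := exists_ncard_eq_circuitRank (Γ := Γ) w
  rw [he]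
  exact (Set.ncard_le_ncard (circuitsIn_mono Γ (List.suffix_cons _ _).isInfix)
    (finite_circuitsIn Γ _)).trans (ncard_le_circuitRank (isWalk_cons_cons.2 ⟨h, hp⟩))

/-- One round of the circuit through `v` is put in front of an optimal walk from `w`. It is a new
circuit, because no walk from `w` reaches `v`. -/
lemma circuitRank_lt_of_adj {v w x : V} (h : Γ.Adj v w) (hwv : ¬ Reach Γ w v)
    (hx : Γ.Adj v x) (hxv : Reach Γ x v) : circuitRank Γ w + 1 ≤ circuitRank Γ v := by
  obtain ⟨p, hp, he⟩ := exists_ncard_eq_circuitRank (Γ := Γ) w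
  obtain ⟨l, hl, -⟩ := exists_circuit_of_adj_of_reach hx hxv
  have hnot : ((v :: l : List V) : Cycle V) ∉ circuitsIn Γ (w :: p) := fun hm =>
    hwv (reach_of_isWalk hp (mem_of_mem_circuitsIn hm (by simp)))
  have hwalk : IsWalk Γ (v :: (l ++ [v] ++ w :: p)) := by
    refine ⟨by simp, ?_⟩
    rw [← List.cons_append]
    refine List.IsChain.append (isCircuit_cons_iff.1 hl).2 hp.2 ?_
    intro a ha b hb
    rw [← List.cons_append, List.getLast?_concat] at ha
    cases ha
    cases hb
    exact h
  have hsub : insert ((v :: l : List V) : Cycle V) (circuitsIn Γ (w :: p)) ⊆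
      circuitsIn Γ (v :: (l ++ [v] ++ w :: p)) := by
    refine Set.insert_subset ⟨hl, v, l, rfl, ⟨[], w :: p, by simp⟩⟩ (circuitsIn_mono Γ ?_)
    exact ⟨v :: (l ++ [v]), [], by simp⟩
  rw [he, ← Set.ncard_insert_of_notMem hnot (finite_circuitsIn Γ _)]
  exact (Set.ncard_le_ncard hsub (finite_circuitsIn Γ _)).trans (ncard_le_circuitRank hwalk)

/-- The number of vertices which can be reached from `v`. -/
def reachRank (Γ : Digraph V) (v : V) : ℕ := {x | Reach Γ v x}.ncard

lemma reachRank_le_of_adj {v w : V} (h : Γ.Adj v w) : reachRank Γ w ≤ reachRank Γ v :=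
  Set.ncard_le_ncard (fun _ hx => Relation.ReflTransGen.head h hx) (Set.toFinite _)

lemma reachRank_lt_of_adj {v w : V} (h : Γ.Adj v w) (hwv : ¬ Reach Γ w v) :
    reachRank Γ w < reachRank Γ v := by
  refine Set.ncard_lt_ncard ⟨fun _ hx => Relation.ReflTransGen.head h hx, fun hsub => ?_⟩
    (Set.toFinite _)
  exact hwv (hsub (Relation.ReflTransGen.refl : Reach Γ v v))

/-- Outer induction on the number of reachable vertices, inner induction on the length. Successors
that do not lead back reach fewer vertices, and their circuit rank is smaller if `v` lies on a
circuit. At most one successor leads back; it is handled by the inner induction. -/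
theorem exists_walksUpTo_le (hM : ¬ HasMeetingCircuits Γ) :
    ∃ C, ∀ v n, walksUpTo Γ n v ≤ C * (n + 1) ^ circuitRank Γ v := by
  classical
  suffices H : ∀ r, ∃ C, ∀ v, reachRank Γ v < r → ∀ n,
      walksUpTo Γ n v ≤ C * (n + 1) ^ circuitRank Γ v by
    obtain ⟨C, hC⟩ := H (Fintype.card V + 1)
    refine ⟨C, fun v => hC v (Nat.lt_succ_of_le ?_)⟩
    rw [← Nat.card_eq_fintype_card, ← Set.ncard_univ]
    exact Set.ncard_le_ncard (Set.subset_univ _) (Set.toFinite _)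
  intro r
  induction r with
  | zero => exact ⟨0, fun v hv => absurd hv (Nat.not_lt_zero _)⟩
  | succ r ih =>
    obtain ⟨C, hC⟩ := ih
    refine ⟨1 + Fintype.card V * C, fun v hv n => ?_⟩
    induction n generalizing v with
    | zero => rw [walksUpTo_zero, zero_add, one_pow]; omega
    | succ n ihn =>
      have hsum : ∀ (s : Finset V) (e : ℕ), (∀ w ∈ s, Γ.Adj v w ∧ ¬ Reach Γ w v ∧
          circuitRank Γ w ≤ e) → 1 + ∑ w ∈ s, walksUpTo Γ n w ≤
            (1 + Fintype.card V * C) * (n + 1) ^ e := by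
        intro s e hs
        have h1 : ∑ w ∈ s, walksUpTo Γ n w ≤ ∑ w ∈ s, C * (n + 1) ^ e := by
          refine Finset.sum_le_sum fun w hw => ?_
          obtain ⟨h2, h3, h4⟩ := hs w hw
          have h5 := reachRank_lt_of_adj h2 h3
          exact (hC w (by omega) n).trans
            (Nat.mul_le_mul_left _ (Nat.pow_le_pow_right (by omega) h4))
        rw [Finset.sum_const, smul_eq_mul] at h1
        have h6 : s.card * (C * (n + 1) ^ e) ≤ Fintype.card V * (C * (n + 1) ^ e) :=
          Nat.mul_le_mul_right _ (Finset.card_le_univ s)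
        have h7 : 1 ≤ (n + 1) ^ e := Nat.one_le_pow _ _ (by omega)
        calc _ ≤ (n + 1) ^ e + Fintype.card V * (C * (n + 1) ^ e) :=
              add_le_add h7 (h1.trans h6)
          _ = _ := by ring
      rw [walksUpTo_succ]
      by_cases hret : ∃ x, Γ.Adj v x ∧ Reach Γ x v
      · obtain ⟨x, hx, hxv⟩ := hret
        have hmem : x ∈ Finset.univ.filter (Γ.Adj v) := by simp [hx]
        rw [← Finset.sum_erase_add _ _ hmem, ← add_assoc]
        obtain ⟨e, he⟩ : ∃ e, circuitRank Γ v = e + 1 := by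
          obtain ⟨l, hl, -⟩ := exists_circuit_of_adj_of_reach hx hxv
          have hwalk : IsWalk Γ (v :: (l ++ [v])) := ⟨by simp, (isCircuit_cons_iff.1 hl).2⟩
          have h1 : 0 < (circuitsIn Γ (v :: (l ++ [v]))).ncard :=
            (Set.ncard_pos (finite_circuitsIn Γ _)).2
              ⟨_, hl, v, l, rfl, ⟨[], [], by simp⟩⟩
          have h2 := ncard_le_circuitRank hwalk
          exact ⟨circuitRank Γ v - 1, by omega⟩
        have h1 := hsum ((Finset.univ.filter (Γ.Adj v)).erase x) e (fun w hw => by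
          rw [Finset.mem_erase, Finset.mem_filter] at hw
          have hwv : ¬ Reach Γ w v := fun h =>
            hw.1 (successor_unique hM hw.2.2 h hx hxv)
          have := circuitRank_lt_of_adj hw.2.2 hwv hx hxv
          exact ⟨hw.2.2, hwv, by omega⟩)
        have h2 := ihn x ((reachRank_le_of_adj hx).trans_lt hv)
        have h3 : (n + 1) ^ circuitRank Γ x ≤ (n + 1) ^ (e + 1) :=
          Nat.pow_le_pow_right (by omega) (he ▸ circuitRank_le_of_adj hx)
        have h4 : (n + 1) ^ e ≤ (n + 1 + 1) ^ e := Nat.pow_le_pow_left (by omega) e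
        rw [he]
        -- The lower-degree contribution of the other successors is absorbed by passing from `n + 1`
        -- to `n + 2`, with the same constant.
        calc _ ≤ (1 + Fintype.card V * C) * (n + 1) ^ e +
              (1 + Fintype.card V * C) * (n + 1) ^ (e + 1) :=
              add_le_add h1 (h2.trans (Nat.mul_le_mul_left _ h3))
          _ = (1 + Fintype.card V * C) * ((n + 1) ^ e * (n + 1 + 1)) := by ring
          _ ≤ (1 + Fintype.card V * C) * ((n + 1 + 1) ^ e * (n + 1 + 1)) := by gcongr
          _ = _ := by rw [pow_succ]
      · push Not at hret
        refine (hsum _ (circuitRank Γ v) fun w hw => ?_).trans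
          (Nat.mul_le_mul_left _ (Nat.pow_le_pow_left (by omega) _))
        have hw := (Finset.mem_filter.1 hw).2
        exact ⟨hw, hret w hw, circuitRank_le_of_adj hw⟩

end WalkGrowth

/-! ### Growth exponents -/

section Growth

open Filter Topology

lemma log_natCast_mono {a b : ℕ} (h : a ≤ b) : Real.log a ≤ Real.log b := by
  rcases a.eq_zero_or_pos with rfl | ha
  · simpa using Real.log_natCast_nonneg b
  · exact Real.log_le_log (by exact_mod_cast ha) (by exact_mod_cast h)

lemma growthExponent_mono {d e : ℕ → ℕ} (h : ∀ n, d n ≤ e n) :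
    growthExponent d ≤ growthExponent e :=
  limsup_le_limsup (Eventually.of_forall fun n => EReal.coe_le_coe_iff.2
    (div_le_div_of_nonneg_right (log_natCast_mono (h n)) (Real.log_natCast_nonneg n)))

lemma tendsto_log_natCast : Tendsto (fun n : ℕ => Real.log n) atTop atTop :=
  Real.tendsto_log_atTop.comp tendsto_natCast_atTop_atTop

lemma limsup_add_div_log (a c : ℝ) :
    limsup (fun n : ℕ => ((a + c / Real.log n : ℝ) : EReal)) atTop = (a : EReal) := by
  refine Tendsto.limsup_eq ?_
  have h : Tendsto (fun n : ℕ => a + c / Real.log n) atTop (𝓝 (a + 0)) :=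
    tendsto_const_nhds.add (tendsto_const_nhds.div_atTop tendsto_log_natCast)
  rw [add_zero] at h
  exact (continuous_coe_real_ereal.tendsto a).comp h

lemma growthExponent_le {D : ℕ → ℕ} {C d : ℕ} (h : ∀ n, D n ≤ C * (n + 1) ^ d) :
    growthExponent D ≤ d := by
  have key : limsup (fun n : ℕ => (((d : ℝ) + Real.log ((C + 1) * 2 ^ d : ℕ) / Real.log n : ℝ) :
      EReal)) atTop = (d : EReal) := limsup_add_div_log _ _
  rw [← key]
  refine limsup_le_limsup ?_
  filter_upwards [eventually_ge_atTop 2] with n hn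
  have hlog : 0 < Real.log n := Real.log_pos (by exact_mod_cast hn)
  rw [EReal.coe_le_coe_iff, div_le_iff₀ hlog, add_mul, div_mul_cancel₀ _ hlog.ne']
  have h1 : D n ≤ (C + 1) * 2 ^ d * n ^ d := by
    calc D n ≤ C * (n + 1) ^ d := h n
      _ ≤ (C + 1) * (2 * n) ^ d := Nat.mul_le_mul (by omega) (Nat.pow_le_pow_left (by omega) d)
      _ = _ := by rw [mul_pow]; ring
  refine (log_natCast_mono h1).trans ?_
  rw [Nat.cast_mul, Real.log_mul, Nat.cast_pow, Real.log_pow, add_comm]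
  · exact_mod_cast (by positivity : (C + 1) * 2 ^ d ≠ 0)
  · exact_mod_cast (pow_pos (by omega) d : 0 < n ^ d).ne'

lemma le_growthExponent {D : ℕ → ℕ} {K c d : ℕ} (hD : ∀ n, 1 ≤ D n)
    (h : ∀ n, n ^ d ≤ K * D (n + c)) : (d : EReal) ≤ growthExponent D := by
  have key : limsup (fun n : ℕ => (((d : ℝ) + (-Real.log (2 ^ d * (K + 1) : ℕ)) / Real.log n : ℝ) :
      EReal)) atTop = (d : EReal) := limsup_add_div_log _ _
  rw [← key]
  refine limsup_le_limsup ?_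
  filter_upwards [eventually_ge_atTop 2, eventually_ge_atTop (2 * c)] with n hn hnc
  have hlog : 0 < Real.log n := Real.log_pos (by exact_mod_cast hn)
  rw [EReal.coe_le_coe_iff, le_div_iff₀ hlog, add_mul, div_mul_cancel₀ _ hlog.ne']
  -- From `n ≥ 2 * c` it follows that `m + c ≤ 2 * m`, so the shift costs only the factor `2 ^ d`.
  obtain ⟨m, rfl⟩ : ∃ m, n = m + c := ⟨n - c, by omega⟩
  have h1 : (m + c) ^ d ≤ 2 ^ d * (K + 1) * D (m + c) := by
    calc (m + c) ^ d ≤ (2 * m) ^ d := Nat.pow_le_pow_left (by omega) d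
      _ = 2 ^ d * m ^ d := mul_pow _ _ _
      _ ≤ 2 ^ d * (K * D (m + c)) := Nat.mul_le_mul_left _ (h m)
      _ ≤ 2 ^ d * ((K + 1) * D (m + c)) :=
        Nat.mul_le_mul_left _ (Nat.mul_le_mul_right _ (by omega))
      _ = _ := by ring
  have h2 := log_natCast_mono h1
  rw [Nat.cast_mul, Real.log_mul, Nat.cast_pow, Real.log_pow] at h2
  · linarith
  · exact_mod_cast (by positivity : 2 ^ d * (K + 1) ≠ 0)
  · exact_mod_cast (Nat.pos_of_ne_zero (by have := hD (m + c); omega)).ne'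

/-- Rescaling the argument is harmless since `log (d * n) / log n` tends to `1`; a real number
strictly between the two bounds absorbs the error. -/
lemma growthExponent_comp_mul_le (D : ℕ → ℕ) {d : ℕ} (hd : 1 ≤ d) :
    growthExponent (fun n => D (d * n)) ≤ growthExponent D := by
  refine EReal.le_of_forall_lt_iff_le.1 fun a ha => ?_
  obtain ⟨b, hb, hba⟩ := EReal.lt_iff_exists_real_btwn.1 ha
  rw [EReal.coe_lt_coe_iff] at hba
  have h1 : ∀ᶠ m : ℕ in atTop, ((Real.log (D m) / Real.log m : ℝ) : EReal) < b :=
    eventually_lt_of_limsup_lt hb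
  have h2 : Tendsto (fun n : ℕ => d * n) atTop atTop :=
    tendsto_id.const_mul_atTop' (by omega)
  have h3 : Tendsto (fun n : ℕ => b + b * Real.log d / Real.log n) atTop (𝓝 (b + 0)) :=
    tendsto_const_nhds.add (tendsto_const_nhds.div_atTop tendsto_log_natCast)
  rw [add_zero] at h3
  refine limsup_le_of_le (h := ?_)
  filter_upwards [h2.eventually h1, h3.eventually (gt_mem_nhds hba), eventually_ge_atTop 2]
    with n hn hn' hn2
  rw [EReal.coe_lt_coe_iff] at hn
  rw [EReal.coe_le_coe_iff]
  refine le_trans ?_ hn'.le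
  have hlog : 0 < Real.log n := Real.log_pos (by exact_mod_cast hn2)
  have hd' : (0 : ℝ) < d := by exact_mod_cast hd
  have hlog' : 0 < Real.log (d * n : ℕ) := Real.log_pos (by
    exact_mod_cast (by nlinarith : 1 < d * n))
  rw [div_lt_iff₀ hlog', Nat.cast_mul, Real.log_mul hd'.ne' (by positivity)] at hn
  rw [div_le_iff₀ hlog, add_mul, div_mul_cancel₀ _ hlog.ne']
  linarith

end Growth

/-! ### The Gelfand-Kirillov dimension of a graded algebra -/

section Graded

open DirectSum

variable {k : Type*} [Field k] {M : ℕ → Type*} [∀ i, AddCommGroup (M i)] [∀ i, Module k (M i)]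

variable (k M) in
/-- The elements of degree at most `n`. -/
def degreeLE (n : ℕ) : Submodule k (⨁ i, M i) :=
  Submodule.span k {z | ∃ i ≤ n, ∃ x : M i, z = of M i x}

lemma of_mem_degreeLE {i n : ℕ} (h : i ≤ n) (x : M i) : of M i x ∈ degreeLE k M n :=
  Submodule.subset_span ⟨i, h, x, rfl⟩

lemma degreeLE_mono {m n : ℕ} (h : m ≤ n) : degreeLE k M m ≤ degreeLE k M n :=
  Submodule.span_mono fun _ ⟨i, hi, x, hx⟩ => ⟨i, hi.trans h, x, hx⟩

lemma apply_eq_zero_of_mem_degreeLE {n : ℕ} {z : ⨁ i, M i} (hz : z ∈ degreeLE k M n) {j : ℕ}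
    (hj : n < j) : z j = 0 := by
  induction hz using Submodule.span_induction with
  | mem z hz =>
    obtain ⟨i, hi, x, rfl⟩ := hz
    exact of_eq_of_ne _ _ _ (by omega)
  | zero => rfl
  | add x y _ _ hx hy => rw [DirectSum.add_apply, hx, hy, add_zero]
  | smul c x _ hx => rw [DirectSum.smul_apply, hx, smul_zero]

lemma exists_mem_degreeLE (z : ⨁ i, M i) : ∃ n, z ∈ degreeLE k M n := by
  induction z using DirectSum.induction_on with
  | zero => exact ⟨0, Submodule.zero_mem _⟩
  | of i x => exact ⟨i, of_mem_degreeLE le_rfl x⟩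
  | add x y hx hy =>
    obtain ⟨m, hm⟩ := hx
    obtain ⟨n, hn⟩ := hy
    exact ⟨max m n, add_mem (degreeLE_mono (le_max_left m n) hm)
      (degreeLE_mono (le_max_right m n) hn)⟩

lemma exists_subset_degreeLE (S : Finset (⨁ i, M i)) :
    ∃ n, 1 ≤ n ∧ (S : Set (⨁ i, M i)) ⊆ degreeLE k M n := by
  choose f hf using exists_mem_degreeLE (k := k) (M := M)
  exact ⟨S.sup f + 1, by omega, fun z hz =>
    degreeLE_mono ((Finset.le_sup (f := f) hz).trans (Nat.le_succ _)) (hf z)⟩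

variable (k M) in
/-- The elements of degree at most `n` are given by their components. -/
def degreeLEEquiv (n : ℕ) : degreeLE k M n ≃ₗ[k] (∀ i : Finset.range (n + 1), M i) := by
  classical
  refine LinearEquiv.ofBijective
    (LinearMap.pi fun i : Finset.range (n + 1) =>
      DirectSum.component k ℕ M i ∘ₗ (degreeLE k M n).subtype) ⟨?_, ?_⟩
  · refine (injective_iff_map_eq_zero _).2 fun z hz => Subtype.ext (DFinsupp.ext fun i => ?_)
    by_cases hi : i < n + 1
    · exact congrFun hz ⟨i, Finset.mem_range.2 hi⟩
    · exact apply_eq_zero_of_mem_degreeLE z.2 (by omega)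
  · intro f
    refine ⟨⟨∑ i : Finset.range (n + 1), of M i (f i), Submodule.sum_mem _ fun i _ =>
      of_mem_degreeLE (Nat.lt_succ_iff.1 (Finset.mem_range.1 i.2)) _⟩, funext fun j => ?_⟩
    change (∑ i : Finset.range (n + 1), of M i (f i)) (j : ℕ) = f j
    rw [DirectSum.sum_apply, Finset.sum_eq_single j]
    · exact of_eq_same _ _
    · exact fun i _ hij => of_eq_of_ne _ _ _ fun h => hij (Subtype.ext h.symm)
    · simp

lemma finite_degreeLE (hfin : ∀ i, Module.Finite k (M i)) (n : ℕ) :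
    Module.Finite k (degreeLE k M n) :=
  Module.Finite.equiv (degreeLEEquiv k M n).symm

lemma finrank_degreeLE (hfin : ∀ i, Module.Finite k (M i)) (n : ℕ) :
    Module.finrank k (degreeLE k M n) = ∑ i ∈ Finset.range (n + 1), Module.finrank k (M i) := by
  rw [(degreeLEEquiv k M n).finrank_eq, Module.finrank_pi_fintype]
  exact Finset.sum_coe_sort _ fun i => Module.finrank k (M i)

variable [GRing M] [GAlgebra k M]

lemma one_le_degreeLE (n : ℕ) : (1 : Submodule k (⨁ i, M i)) ≤ degreeLE k M n := by
  rw [Submodule.one_le]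
  exact of_mem_degreeLE n.zero_le _

lemma degreeLE_pow_le (d n : ℕ) : degreeLE k M d ^ n ≤ degreeLE k M (d * n) := by
  induction n with
  | zero => rw [pow_zero]; exact one_le_degreeLE _
  | succ n ih =>
    rw [pow_succ]
    refine (mul_le_mul_left ih _).trans ?_
    rw [degreeLE, degreeLE, Submodule.span_mul_span]
    refine Submodule.span_le.2 ?_
    rintro _ ⟨_, ⟨i, hi, x, rfl⟩, _, ⟨j, hj, y, rfl⟩, rfl⟩
    simp only [of_mul_of]
    exact of_mem_degreeLE (by rw [mul_add, mul_one]; omega) _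

/-- Homogeneous generators of positive degree contribute at least `1` to the degree, and those of
degree `0` are scalars, so `i` factors suffice in degree `i`. The homogeneous elements with this
property span a subalgebra containing the generators. -/
lemma of_mem_pow_of_adjoin_eq_top (h0 : ∀ x : M 0, of M 0 x ∈ (1 : Submodule k (⨁ i, M i)))
    {d : ℕ} (hd : Algebra.adjoin k (degreeLE k M d : Set (⨁ i, M i)) = ⊤) {i : ℕ} (x : M i) :
    of M i x ∈ degreeLE k M d ^ i := by
  let T : Set (⨁ i, M i) := {z | ∃ i, ∃ x : M i, z = of M i x ∧ of M i x ∈ degreeLE k M d ^ i}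
  have hone : (1 : ⨁ i, M i) ∈ Submodule.span k T :=
    Submodule.subset_span ⟨0, GradedMonoid.GOne.one, rfl, by
      rw [pow_zero]; exact Submodule.one_le.1 le_rfl⟩
  have hmul : ∀ x y, x ∈ Submodule.span k T → y ∈ Submodule.span k T →
      x * y ∈ Submodule.span k T := by
    intro x y hx hy
    have := Submodule.mul_mem_mul hx hy
    rw [Submodule.span_mul_span] at this
    refine Submodule.span_mono ?_ this
    rintro _ ⟨_, ⟨i, x, rfl, hx⟩, _, ⟨j, y, rfl, hy⟩, rfl⟩
    simp only [of_mul_of]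
    refine ⟨i + j, _, rfl, ?_⟩
    rw [← of_mul_of, pow_add]
    exact Submodule.mul_mem_mul hx hy
  have hle : Algebra.adjoin k (degreeLE k M d : Set (⨁ i, M i)) ≤
      (Submodule.span k T).toSubalgebra hone hmul := by
    refine Algebra.adjoin_le ?_
    change degreeLE k M d ≤ Submodule.span k T
    refine Submodule.span_le.2 ?_
    rintro _ ⟨i, hi, x, rfl⟩
    refine Submodule.subset_span ⟨i, x, rfl, ?_⟩
    rcases i.eq_zero_or_pos with rfl | hi0
    · rw [pow_zero]; exact h0 x
    · obtain ⟨j, rfl⟩ : ∃ j, i = j + 1 := ⟨i - 1, by omega⟩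
      rw [pow_succ]
      have h1 : (1 : Submodule k (⨁ i, M i)) ≤ degreeLE k M d ^ j := one_le_pow₀ (one_le_degreeLE d)
      have := Submodule.mul_mem_mul (Submodule.one_le.1 h1) (of_mem_degreeLE (k := k) hi x)
      rwa [one_mul] at this
  have hx : of M i x ∈ Submodule.span k T := by
    have : of M i x ∈ Algebra.adjoin k (degreeLE k M d : Set (⨁ i, M i)) := by rw [hd]; trivial
    exact hle this
  -- Homogeneous components are taken to pass from the span back to a single degree.
  have hproj : ∀ z ∈ Submodule.span k T, of M i (z i) ∈ degreeLE k M d ^ i := by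
    intro z hz
    induction hz using Submodule.span_induction with
    | mem z hz =>
      obtain ⟨j, y, rfl, hy⟩ := hz
      by_cases hij : i = j
      · subst hij
        rwa [of_eq_same]
      · rw [of_eq_of_ne _ _ _ hij, map_zero]
        exact Submodule.zero_mem _
    | zero => rw [DirectSum.zero_apply, map_zero]; exact Submodule.zero_mem _
    | add x y _ _ hx hy => rw [DirectSum.add_apply, map_add]; exact add_mem hx hy
    | smul c x _ hx =>
      have : of M i ((c • x) i) = c • of M i (x i) := (lof k ℕ M i).map_smul c (x i)
      rw [this]
      exact Submodule.smul_mem _ _ hx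
  have := hproj _ hx
  rwa [of_eq_same] at this

/-- For a finitely generated connected graded algebra, the graded and the ungraded
Gelfand-Kirillov dimensions agree. -/
theorem algebraGKDim_eq_gradedGKDim (hfin : ∀ i, Module.Finite k (M i))
    (h0 : ∀ x : M 0, of M 0 x ∈ (1 : Submodule k (⨁ i, M i)))
    (hfg : Algebra.FiniteType k (⨁ i, M i)) :
    algebraGKDim k (⨁ i, M i) = gradedGKDim k M := by
  apply le_antisymm
  · refine iSup₂_le fun W hW => ?_
    obtain ⟨S, rfl⟩ := hW
    obtain ⟨d, hd, hS⟩ := exists_subset_degreeLE (k := k) S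
    refine le_trans (growthExponent_mono fun n => ?_) (growthExponent_comp_mul_le
      (fun n => ∑ i ∈ Finset.range (n + 1), Module.finrank k (M i)) hd)
    have h1 : (1 ⊔ Submodule.span k (S : Set (⨁ i, M i))) ^ n ≤ degreeLE k M (d * n) :=
      (pow_le_pow_left' (sup_le (one_le_degreeLE d) (Submodule.span_le.2 hS)) n).trans
        (degreeLE_pow_le d n)
    have := finite_degreeLE (k := k) hfin (d * n)
    rw [← finrank_degreeLE hfin]
    exact Submodule.finrank_mono h1
  · obtain ⟨S, hS⟩ := hfg.out
    obtain ⟨d, hd, hSd⟩ := exists_subset_degreeLE (k := k) S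
    have htop : Algebra.adjoin k (degreeLE k M d : Set (⨁ i, M i)) = ⊤ :=
      top_le_iff.1 (hS ▸ Algebra.adjoin_mono hSd)
    have hFG : (degreeLE k M d).FG := Module.Finite.iff_fg.1 (finite_degreeLE hfin d)
    refine le_trans (growthExponent_mono fun n => ?_) (le_iSup₂_of_le (degreeLE k M d) hFG le_rfl)
    rw [← finrank_degreeLE hfin, sup_eq_right.2 (one_le_degreeLE d)]
    have h1 : degreeLE k M n ≤ degreeLE k M d ^ n := by
      refine Submodule.span_le.2 ?_
      rintro _ ⟨i, hi, x, rfl⟩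
      have h2 : degreeLE k M d ^ i ≤ degreeLE k M d ^ n :=
        pow_le_pow_right₀ (one_le_degreeLE d) hi
      exact h2 (of_mem_pow_of_adjoin_eq_top h0 htop x)
    have h2 : Module.Finite k (degreeLE k M d ^ n : Submodule k (⨁ i, M i)) :=
      Module.Finite.iff_fg.2 (hFG.pow n)
    exact Submodule.finrank_mono h1

end Graded

/-! ### Rationality of the generating series of walks -/

section Rational

variable {V : Type*} [Fintype V] (Γ : Digraph V)

/-- The generating series of the walks starting at `v`. -/
def walkSeries (v : V) : PowerSeries ℚ := PowerSeries.mk fun n => (walkCount Γ n v : ℚ)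

open scoped Classical in
/-- The matrix `1 - t B`, with `B` the adjacency matrix. -/
def transferMatrix : Matrix V V (Polynomial ℚ) :=
  1 - Matrix.of fun v w => if Γ.Adj v w then Polynomial.X else 0

open scoped Classical in
lemma walkSeries_eq (v : V) :
    walkSeries Γ v = 1 + PowerSeries.X * ∑ w with Γ.Adj v w, walkSeries Γ w := by
  ext n
  cases n with
  | zero => simp [walkSeries, walkCount]
  | succ n =>
    rw [map_add, PowerSeries.coeff_succ_X_mul, map_sum, PowerSeries.coeff_one, if_neg (by omega),
      zero_add]
    simp [walkSeries, walkCount_succ]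

open scoped Classical in
lemma transferMatrix_mulVec :
    ((transferMatrix Γ).map Polynomial.coeToPowerSeries.ringHom).mulVec (walkSeries Γ) = 1 := by
  ext1 v
  have h : (transferMatrix Γ).map Polynomial.coeToPowerSeries.ringHom =
      1 - Matrix.of fun v w => if Γ.Adj v w then (PowerSeries.X : PowerSeries ℚ) else 0 := by
    ext1 v w
    rw [Matrix.map_apply, transferMatrix, Matrix.sub_apply, Matrix.sub_apply, map_sub,
      Matrix.one_apply, Matrix.one_apply, Matrix.of_apply, Matrix.of_apply]
    split_ifs <;> simp
  rw [h, Matrix.sub_mulVec, Matrix.one_mulVec, Pi.sub_apply, Pi.one_apply, Matrix.mulVec,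
    dotProduct, walkSeries_eq, Finset.mul_sum, Finset.sum_filter]
  simp [ite_mul]

-- Cramer's rule: multiply the system `(1 - t B) W = 1` by the adjugate.
open scoped Classical in
lemma det_mul_walkSeries (v : V) :
    ((transferMatrix Γ).det : PowerSeries ℚ) * walkSeries Γ v =
      (((transferMatrix Γ).adjugate.mulVec 1 v : Polynomial ℚ) : PowerSeries ℚ) := by
  have h := congrArg
    (((transferMatrix Γ).map Polynomial.coeToPowerSeries.ringHom).adjugate.mulVec)
    (transferMatrix_mulVec Γ)
  rw [Matrix.mulVec_mulVec, Matrix.adjugate_mul, Matrix.smul_mulVec, Matrix.one_mulVec] at h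
  have h1 := congrFun h v
  have h2 := Polynomial.coeToPowerSeries.ringHom.map_det (transferMatrix Γ)
  have h3 := Polynomial.coeToPowerSeries.ringHom.map_adjugate (transferMatrix Γ)
  rw [RingHom.mapMatrix_apply] at h2 h3
  rw [RingHom.mapMatrix_apply] at h3
  rw [← h2, ← h3, Pi.smul_apply, smul_eq_mul] at h1
  refine h1.trans ?_
  rw [← Polynomial.coeToPowerSeries.ringHom_apply, Matrix.mulVec, Matrix.mulVec, dotProduct,
    dotProduct, map_sum]
  simp

open scoped Classical in
lemma det_transferMatrix_coeff_zero : (transferMatrix Γ).det.coeff 0 = 1 := by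
  have h := (Polynomial.evalRingHom (0 : ℚ)).map_det (transferMatrix Γ)
  have h1 : (Polynomial.evalRingHom (0 : ℚ)).mapMatrix (transferMatrix Γ) = 1 := by
    ext1 v w
    rw [RingHom.mapMatrix_apply, Matrix.map_apply, transferMatrix, Matrix.sub_apply, map_sub,
      Matrix.one_apply, Matrix.one_apply, Matrix.of_apply]
    split_ifs <;> simp
  rw [h1, Matrix.det_one] at h
  rw [Polynomial.coeff_zero_eq_eval_zero]
  exact h

theorem exists_polynomial_mul_walkSeries :
    ∃ (Q : Polynomial ℚ) (P : V → Polynomial ℚ), Q.coeff 0 = 1 ∧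
      ∀ v, (Q : PowerSeries ℚ) * walkSeries Γ v = (P v : PowerSeries ℚ) := by
  classical
  exact ⟨_, _, det_transferMatrix_coeff_zero Γ, det_mul_walkSeries Γ⟩

end Rational

/-! ### Walks and paths -/

section Paths

variable {V : Type*} [Fintype V] {Γ : Digraph V}

lemma walkCount_ne_zero_iff (n : ℕ) (v : V) :
    walkCount Γ n v ≠ 0 ↔ ∃ p, IsWalk Γ (v :: p) ∧ p.length = n := by
  classical
  induction n generalizing v with
  | zero => exact ⟨fun _ => ⟨[], by simp [IsWalk], rfl⟩, fun _ => one_ne_zero⟩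
  | succ n ih =>
    rw [walkCount_succ, Ne, Finset.sum_eq_zero_iff]
    push Not
    constructor
    · rintro ⟨w, hw, hn⟩
      obtain ⟨p, hp, rfl⟩ := (ih w).1 hn
      exact ⟨w :: p, isWalk_cons_cons.2 ⟨(Finset.mem_filter.1 hw).2, hp⟩, rfl⟩
    · rintro ⟨p, hp, hn⟩
      cases p with
      | nil => simp at hn
      | cons w p =>
        obtain ⟨h1, h2⟩ := isWalk_cons_cons.1 hp
        exact ⟨w, by simp [h1], (ih w).2 ⟨p, h2, Nat.succ_injective hn⟩⟩

/-- A repeated vertex closes up a part of the walk, and a closed walk yields a circuit. -/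
lemma nodup_of_isWalk (hΓ : ¬ ∃ c, IsCircuit Γ c) (p : List V) (hp : IsWalk Γ p) : p.Nodup := by
  induction p with
  | nil => exact List.nodup_nil
  | cons v p ih =>
    cases p with
    | nil => simp
    | cons w p =>
      obtain ⟨h1, h2⟩ := isWalk_cons_cons.1 hp
      refine List.nodup_cons.2 ⟨fun hv => hΓ ?_, ih h2⟩
      obtain ⟨l, hl, -⟩ := exists_circuit_of_adj_of_reach h1 (reach_of_isWalk h2 hv)
      exact ⟨_, hl⟩

lemma maxPathVertices_le_card : maxPathVertices Γ ≤ Fintype.card V :=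
  iSup₂_le fun _ hp => by exact_mod_cast hp.2.length_le_card

lemma exists_maxPathVertices_eq (N : ℕ) (hN : maxPathVertices Γ = (N + 1 : ℕ)) :
    ∃ v p, IsWalk Γ (v :: p) ∧ p.length = N := by
  by_contra! h
  have : maxPathVertices Γ ≤ (N : ℕ) := by
    refine iSup₂_le fun p hp => ?_
    have h1 : (p.length : ℕ∞) ≤ (N + 1 : ℕ) :=
      hN ▸ le_iSup₂ (f := fun (p : List V) (_ : IsPath Γ p) => (p.length : ℕ∞)) p hp
    obtain ⟨v, q, rfl⟩ := List.exists_cons_of_ne_nil hp.1.1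
    have h2 := h v q hp.1
    rw [Nat.cast_le, List.length_cons] at h1
    rw [Nat.cast_le, List.length_cons]
    omega
  rw [hN, Nat.cast_le] at this
  omega

end Paths

/-! ### The Yoneda algebra of a monomial algebra -/

section Yoneda

variable (k : Type u) [Field k] {s : ℕ} {R : Finset (FreeMonoid (Fin s))}

/-- `E(A)` counts only walks from letters; this makes paths and circuits anywhere in the graph
visible to it. -/
lemma exists_letter_reach (v : Vertex k R) : ∃ a, Reach (cpsGraph k R) (letter k R a) v := by
  obtain ⟨w, hw⟩ := v
  induction hw with
  | letter a => exact ⟨a, .refl⟩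
  | @step m w hm hw ih =>
    obtain ⟨a, ha⟩ := ih
    exact ⟨a, ha.tail hw⟩

variable (hR : DegreesAtLeastTwo R)

lemma finrank_E_zero : Module.finrank k (E k hR 0) = 1 := by
  have := finite_vertex k R
  have := Fintype.ofFinite (Vertex k R)
  rw [(finite_ext_and_finrank k hR 0).2]
  exact Nat.card_unique (α := Unit)

variable [Fintype (Vertex k R)]

lemma finrank_E_succ (n : ℕ) :
    Module.finrank k (E k hR (n + 1)) = ∑ a, walkCount (cpsGraph k R) n (letter k R a) := by
  rw [(finite_ext_and_finrank k hR (n + 1)).2, (finite_rootChain_and_card k hR n).2]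

lemma sum_finrank_E_succ (n : ℕ) :
    ∑ i ∈ Finset.range (n + 1 + 1), Module.finrank k (E k hR i) =
      1 + ∑ a, walksUpTo (cpsGraph k R) n (letter k R a) := by
  rw [Finset.sum_range_succ', finrank_E_zero, add_comm]
  simp_rw [finrank_E_succ, walksUpTo]
  rw [Finset.sum_comm]

lemma le_leftGlobalDimension (n : ℕ) (h : Module.finrank k (E k hR n) ≠ 0) :
    (n : WithBot ℕ∞) ≤ leftGlobalDimension (MonomialAlgebra k R) := by
  refine le_trans ?_ (le_iSup projectiveDimension (trivialModule k hR))
  rw [projectiveDimension_ge_iff]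
  intro hlt
  have : Subsingleton (E k hR n) :=
    subsingleton_of_forall_eq 0 fun e => Ext.eq_zero_of_hasProjectiveDimensionLT e n le_rfl
  exact h Module.finrank_zero_of_subsingleton

lemma exists_finrank_E_ne_zero {n : ℕ} {v : Vertex k R} (h : walkCount (cpsGraph k R) n v ≠ 0) :
    ∃ m ≥ n + 1, Module.finrank k (E k hR m) ≠ 0 := by
  obtain ⟨a, ha⟩ := exists_letter_reach k v
  have key : ∃ m ≥ n, walkCount (cpsGraph k R) m (letter k R a) ≠ 0 := by
    generalize letter k R a = b at ha
    induction ha using Relation.ReflTransGen.head_induction_on with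
    | refl => exact ⟨n, le_rfl, h⟩
    | head hab _ ih =>
      obtain ⟨m, hm, hm'⟩ := ih
      obtain ⟨p, hp, rfl⟩ := (walkCount_ne_zero_iff _ _).1 hm'
      exact ⟨p.length + 1, by omega,
        (walkCount_ne_zero_iff _ _).2 ⟨_ :: p, isWalk_cons_cons.2 ⟨hab, hp⟩, rfl⟩⟩
  obtain ⟨m, hm, hm'⟩ := key
  refine ⟨m + 1, by omega, ?_⟩
  rw [finrank_E_succ]
  exact fun h0 => hm' (Finset.sum_eq_zero_iff.1 h0 a (Finset.mem_univ a))

-- An arbitrary module is presented by a `k`-basis whose minimal words are the letters, so its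
-- resolution ends as soon as walks do.
include hR in
lemma leftGlobalDimension_le (n : ℕ) (h : ∀ v, walkCount (cpsGraph k R) n v = 0) :
    leftGlobalDimension (MonomialAlgebra k R) ≤ n := by
  refine iSup_le fun M => ?_
  rw [projectiveDimension_le_iff]
  let _ : Module k M := ModuleCat.moduleOfAlgebraModule M
  have _ : IsScalarTower k (MonomialAlgebra k R) M := ModuleCat.isScalarTower_of_algebra_moduleCat M
  have hpres := isPresentation_basis (φ := word k R) (one_notMem_zeroWords k hR)
    (fun u v h => by
      have := congrArg FreeMonoid.length h
      rw [FreeMonoid.length_mul, FreeMonoid.length_one] at this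
      exact FreeMonoid.length_eq_zero.1 (by omega)) (Module.Basis.ofVectorSpace k M)
  refine hpres.hasProjectiveDimensionLT (isMonomialBasis k R) (n + 1) fun j => ?_
  obtain ⟨h1, h2⟩ := finite_rootChain_and_card k hR n
  rw [Finset.sum_eq_zero fun a _ => h _] at h2
  exact (Finite.card_eq_zero_iff).1 h2

include hR in
theorem leftGlobalDimension_of_no_circuit (hΓ : ¬ ∃ c, IsCircuit (cpsGraph k R) c) :
    leftGlobalDimension (MonomialAlgebra k R) =
      ((maxPathVertices (cpsGraph k R) : ℕ∞) : WithBot ℕ∞) := by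
  obtain ⟨N, hN⟩ := ENat.ne_top_iff_exists.1
    (ne_top_of_le_ne_top (ENat.natCast_ne_top _) (maxPathVertices_le_card (Γ := cpsGraph k R)))
  rw [← hN]
  refine le_antisymm (leftGlobalDimension_le k hR N fun v => ?_) ?_
  · by_contra h
    obtain ⟨p, hp, rfl⟩ := (walkCount_ne_zero_iff _ _).1 h
    have h1 : (((v :: p).length : ℕ) : ℕ∞) ≤ maxPathVertices (cpsGraph k R) :=
      le_iSup₂ (f := fun (p : List (Vertex k R)) (_ : IsPath (cpsGraph k R) p) => (p.length : ℕ∞))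
        (v :: p) ⟨hp, nodup_of_isWalk hΓ _ hp⟩
    rw [← hN, Nat.cast_le, List.length_cons] at h1
    omega
  · cases N with
    -- For the empty graph the lower bound `0` comes from `Ext^0(k, k) ≠ 0`.
    | zero => exact le_leftGlobalDimension k hR 0 (by rw [finrank_E_zero]; exact one_ne_zero)
    | succ N =>
      obtain ⟨v, p, hp, hl⟩ := exists_maxPathVertices_eq N hN.symm
      obtain ⟨m, hm, hm'⟩ := exists_finrank_E_ne_zero k hR
        ((walkCount_ne_zero_iff _ _).2 ⟨p, hp, hl⟩)
      refine le_trans ?_ (le_leftGlobalDimension k hR m hm')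
      exact_mod_cast hm

include hR in
theorem leftGlobalDimension_of_circuit (hΓ : ∃ c, IsCircuit (cpsGraph k R) c) :
    leftGlobalDimension (MonomialAlgebra k R) = ⊤ := by
  obtain ⟨c, hc⟩ := hΓ
  obtain ⟨v, hv⟩ : ∃ v, v ∈ c := by
    induction c using Cycle.induction_on with
    | nil => exact absurd rfl hc.1
    | cons a l _ => exact ⟨a, by simp⟩
  obtain ⟨w, _, hvw, hwv⟩ := exists_successor_of_isCircuit hc hv
  have h : ∀ n : ℕ, (n : WithBot ℕ∞) ≤ leftGlobalDimension (MonomialAlgebra k R) := by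
    intro n
    obtain ⟨m, hm, hm'⟩ := exists_finrank_E_ne_zero k hR
      (Nat.one_le_iff_ne_zero.1 (one_le_walkCount_of_returning n hvw hwv))
    refine le_trans ?_ (le_leftGlobalDimension k hR m hm')
    exact_mod_cast (by omega : n ≤ m)
  generalize leftGlobalDimension (MonomialAlgebra k R) = x at h
  induction x with
  | bot => exact absurd (h 0) (by simp)
  | coe x =>
    have : x = ⊤ := ENat.eq_top_iff_forall_ge.2 fun n => by exact_mod_cast h n
    rw [this]
    rfl

lemma one_le_sum_finrank_E (n : ℕ) :
    1 ≤ ∑ i ∈ Finset.range (n + 1), Module.finrank k (E k hR i) := by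
  refine (finrank_E_zero k hR).ge.trans ?_
  exact Finset.single_le_sum (f := fun i => Module.finrank k (E k hR i))
    (fun _ _ => Nat.zero_le _) (Finset.mem_range.2 (Nat.succ_pos n))

lemma GrowsAtLeast.le_gradedGKDim {v : Vertex k R} {d : ℕ}
    (h : GrowsAtLeast (cpsGraph k R) v d) : (d : EReal) ≤ gradedGKDim k (E k hR) := by
  obtain ⟨a, ha⟩ := exists_letter_reach k v
  obtain ⟨K, hK⟩ := h.of_reach ha
  refine le_growthExponent (K := K) (c := 1) (one_le_sum_finrank_E k hR) fun n => ?_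
  refine (hK n).trans (Nat.mul_le_mul_left _ ?_)
  rw [sum_finrank_E_succ]
  exact (Finset.single_le_sum (f := fun a => walksUpTo (cpsGraph k R) n (letter k R a))
    (fun _ _ => Nat.zero_le _) (Finset.mem_univ a)).trans (Nat.le_add_left _ _)

theorem gradedGKDim_of_meeting (hM : HasMeetingCircuits (cpsGraph k R)) :
    gradedGKDim k (E k hR) = ⊤ := by
  obtain ⟨u, hu⟩ := exists_growsAtLeast_of_meeting hM
  refine EReal.eq_top_iff_forall_lt _ |>.2 fun x => ?_
  obtain ⟨d, hd⟩ := exists_nat_gt x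
  exact lt_of_lt_of_le (by exact_mod_cast hd) ((hu d).le_gradedGKDim k hR)

theorem gradedGKDim_of_not_meeting (hM : ¬ HasMeetingCircuits (cpsGraph k R)) :
    ∃ d : ℕ, maxCircuitsInWalk (cpsGraph k R) = d ∧ gradedGKDim k (E k hR) = d := by
  have hrank : ∀ v, circuitRank (cpsGraph k R) v ≤
      Finset.univ.sup (circuitRank (cpsGraph k R)) := fun v => Finset.le_sup (Finset.mem_univ v)
  have hmax : Finset.univ.sup (circuitRank (cpsGraph k R)) = 0 ∨
      ∃ v, circuitRank (cpsGraph k R) v = Finset.univ.sup (circuitRank (cpsGraph k R)) := by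
    -- With no vertices the supremum is `0` by convention and is attained nowhere.
    rcases isEmpty_or_nonempty (Vertex k R) with h | h
    · left; simp
    · right
      obtain ⟨v, -, hv⟩ := Finset.exists_mem_eq_sup Finset.univ Finset.univ_nonempty
        (circuitRank (cpsGraph k R))
      exact ⟨v, hv.symm⟩
  refine ⟨Finset.univ.sup (circuitRank (cpsGraph k R)), le_antisymm ?_ ?_, le_antisymm ?_ ?_⟩
  · refine iSup₂_le fun p hp => ?_
    obtain ⟨v, q, rfl⟩ := List.exists_cons_of_ne_nil hp.1
    change (circuitsIn (cpsGraph k R) (v :: q)).encard ≤ _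
    rw [← (finite_circuitsIn _ _).cast_ncard_eq, Nat.cast_le]
    exact (ncard_le_circuitRank hp).trans (hrank v)
  · rcases hmax with h | ⟨v, hv⟩
    · rw [h]; simp
    · obtain ⟨p, hp, he⟩ := exists_ncard_eq_circuitRank (Γ := cpsGraph k R) v
      rw [← hv, he, (finite_circuitsIn _ _).cast_ncard_eq]
      exact le_iSup₂ (f := fun (p : List (Vertex k R)) (_ : IsWalk (cpsGraph k R) p) =>
        (circuitsIn (cpsGraph k R) p).encard) (v :: p) hp
  · obtain ⟨C, hC⟩ := exists_walksUpTo_le hM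
    refine growthExponent_le (C := 1 + s * C) fun n => ?_
    have hone : ∀ n, 1 ≤ (n + 1) ^ Finset.univ.sup (circuitRank (cpsGraph k R)) :=
      fun n => Nat.one_le_pow _ _ (Nat.succ_pos n)
    cases n with
    | zero =>
      rw [Finset.sum_range_one, finrank_E_zero]
      exact Nat.mul_le_mul (Nat.le_add_right 1 _) (hone 0)
    | succ n =>
      rw [sum_finrank_E_succ, add_mul, one_mul]
      refine add_le_add (hone _) ?_
      calc ∑ a, walksUpTo (cpsGraph k R) n (letter k R a)
          ≤ ∑ _a : Fin s, C * (n + 1 + 1) ^ Finset.univ.sup (circuitRank (cpsGraph k R)) := by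
            refine Finset.sum_le_sum fun a _ => (hC _ n).trans (Nat.mul_le_mul_left _ ?_)
            exact (Nat.pow_le_pow_right (Nat.succ_pos n) (hrank _)).trans
              (Nat.pow_le_pow_left (Nat.le_succ _) _)
        _ = _ := by rw [Finset.sum_const, Finset.card_univ, Fintype.card_fin, smul_eq_mul, mul_assoc]
  · rcases hmax with h | ⟨v, hv⟩
    · rw [h]
      exact le_growthExponent (K := 1) (c := 0) (one_le_sum_finrank_E k hR) fun n => by
        simpa using one_le_sum_finrank_E k hR n
    · obtain ⟨p, hp, he⟩ := exists_ncard_eq_circuitRank (Γ := cpsGraph k R) v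
      rw [← hv, he]
      exact (growsAtLeast_of_isWalk hM v p hp).le_gradedGKDim k hR

theorem isRationalSeries_hilbertSeries : IsRationalSeries (hilbertSeries k (E k hR)) := by
  have hH : hilbertSeries k (E k hR) =
      1 + PowerSeries.X * ∑ a, walkSeries (cpsGraph k R) (letter k R a) := by
    ext n
    cases n with
    | zero => simp [hilbertSeries, finrank_E_zero]
    | succ n =>
      rw [map_add, PowerSeries.coeff_succ_X_mul, map_sum, PowerSeries.coeff_one, if_neg (by omega),
        zero_add]
      simp [hilbertSeries, walkSeries, finrank_E_succ]
  obtain ⟨Q, P, hQ, h⟩ := exists_polynomial_mul_walkSeries (cpsGraph k R)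
  refine ⟨Q + Polynomial.X * ∑ a, P (letter k R a), Q, by rw [hQ]; exact one_ne_zero, ?_⟩
  rw [hH, mul_add, mul_one, mul_left_comm, Finset.mul_sum,
    Finset.sum_congr rfl fun a _ => h (letter k R a)]
  simp only [← Polynomial.coeToPowerSeries.ringHom_apply, map_add, map_mul, map_sum]
  simp

-- `Ext^0(k, k)` is one-dimensional and the identity is a nonzero element of it: otherwise composing
-- with it would kill all of `Ext^0`.
omit [Fintype (Vertex k R)] in
lemma of_zero_mem_one (x : E k hR 0) :
    DirectSum.of (E k hR) 0 x ∈ (1 : Submodule k (YonedaAlgebra k hR)) := by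
  have h0 : (Ext.mk₀ (𝟙 (trivialModule k hR)) : E k hR 0) ≠ 0 := by
    intro h
    have : Subsingleton (E k hR 0) := subsingleton_of_forall_eq 0 fun y => by
      have := Ext.mk₀_id_comp y
      rw [h, Ext.zero_comp] at this
      exact this.symm
    have h1 := finrank_E_zero k hR
    rw [Module.finrank_zero_of_subsingleton] at h1
    exact zero_ne_one h1
  obtain ⟨c, rfl⟩ := (finrank_eq_one_iff_of_nonzero' _ h0).1 (finrank_E_zero k hR) x
  exact Submodule.mem_one.2 ⟨c, rfl⟩

end Yoneda

end CPS

end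

/-! ### The invariants of `A` and `E(A)` read off from `Γ(A)`. -/

theorem corollary2p5 (k : Type u) [Field k] {s : ℕ} (R : Finset (FreeMonoid (Fin s)))
    (hR : CPS.DegreesAtLeastTwo R) :
    -- the graph is finite
    Finite {w : FreeMonoid (Fin s) // CPS.IsVertex k R w} ∧
    -- global dimension
    ((¬ ∃ c, CPS.IsCircuit (CPS.cpsGraph k R) c) →
      CPS.leftGlobalDimension (CPS.MonomialAlgebra k R) =
        ((CPS.maxPathVertices (CPS.cpsGraph k R) : ℕ∞) : WithBot ℕ∞)) ∧
    ((∃ c, CPS.IsCircuit (CPS.cpsGraph k R) c) →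
      CPS.leftGlobalDimension (CPS.MonomialAlgebra k R) = ⊤) ∧
    -- `E(A)` is locally finite, and its dimension as a graded algebra is the ungraded
    -- Gelfand-Kirillov dimension whenever `E(A)` is finitely generated
    (∀ i, Module.Finite k (CPS.E k hR i)) ∧
    (Algebra.FiniteType k (CPS.YonedaAlgebra k hR) →
      CPS.algebraGKDim k (CPS.YonedaAlgebra k hR) = CPS.gradedGKDim k (CPS.E k hR)) ∧
    -- infinite Gelfand-Kirillov dimension
    (CPS.gradedGKDim k (CPS.E k hR) = ⊤ ↔ CPS.HasMeetingCircuits (CPS.cpsGraph k R)) ∧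
    -- finite Gelfand-Kirillov dimension
    (¬ CPS.HasMeetingCircuits (CPS.cpsGraph k R) →
      CPS.gradedGKDim k (CPS.E k hR) =
        (((CPS.maxCircuitsInWalk (CPS.cpsGraph k R) : ℕ∞) : ℝ≥0∞) : EReal)) ∧
    -- the Hilbert series
    CPS.IsRationalSeries (CPS.hilbertSeries k (CPS.E k hR)) := by
  have hV := CPS.finite_vertex k R
  have := Fintype.ofFinite (CPS.Vertex k R)
  have hfin := fun i => (CPS.finite_ext_and_finrank k hR i).1
  refine ⟨hV, CPS.leftGlobalDimension_of_no_circuit k hR,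
    CPS.leftGlobalDimension_of_circuit k hR, hfin,
    CPS.algebraGKDim_eq_gradedGKDim hfin (CPS.of_zero_mem_one k hR),
    ⟨fun h => ?_, CPS.gradedGKDim_of_meeting k hR⟩, fun hM => ?_,
    CPS.isRationalSeries_hilbertSeries k hR⟩
  · by_contra hM
    obtain ⟨d, -, hd⟩ := CPS.gradedGKDim_of_not_meeting k hR hM
    rw [h] at hd
    exact EReal.natCast_ne_top d hd.symm
  · obtain ⟨d, hd, hd'⟩ := CPS.gradedGKDim_of_not_meeting k hR hM
    rw [hd, hd', ENat.toENNReal_coe]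
    rfl
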